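/- Let $n\ge 1$, $1<p<q$ with $q\le p\,\frac{n+1}{n}$, and let $m,M,K>0$. There are constants $m',M',K'>0$, depending only on $n,p,q,m,M,K$, such that the following holds. Let $\Omega\subset\mathbb R^n$ be open and let $f:\Omega\times\mathbb R^n\to[0,+\infty)$, $f=f(x,\xi)$, be strictly convex in $\xi$ for every $x\in\Omega$ and satisfy, for a.e. $x\in\Omega$ and all $\xi,\lambda\in\mathbb R^n$: (H1) $f(x,\cdot)\in C^2(\mathbb R^n)$; (H2) $m(1+|\xi|^2)^{\frac{p-2}{2}}|\lambda|^2\le\sum_{i,j=1}^n f_{\xi_i\xi_j}(x,\xi)\lambda_i\lambda_j$; (H3) $|f_{\xi\xi}(x,\xi)|\le M(1+|\xi|^2)^{\frac{q-2}{2}}$; (H4) $|f_{\xi x}(x,\xi)|\le K(1+|\xi|^2)^{\frac{q-1}{2}}$, where $f_{\xi x}(\cdot,\xi)$ is the weak derivative in $x$ of $x\mapsto f_\xi(x,\xi)$ on $\Omega$. Here $|\cdot|$ of a matrix denotes the operator norm. Assume moreover: (H5) there is a function $c(\varepsilon)\ge1$, $\varepsilon>0$, with $c(\varepsilon)\to1$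 as $\varepsilon\to0^+$, such that for every $\varepsilon>0$ and every $x\in\Omega$ with $B_\varepsilon(x)\Subset\Omega$ there is $\tilde y\in\overline{B_\varepsilon(x)}$ with $f(\tilde y,\xi)\le c(\varepsilon)f(y,\xi)$ for all $(y,\xi)\in B_\varepsilon(x)\times\mathbb R^n$; (H6) there is $H>0$ such that $|f(x,\xi)-f(y,\xi)|\le H|x-y|(1+|\xi|^2)^{\frac q2}$ for all $x,y\in\Omega$ and $\xi\in\mathbb R^n$. Then for every ball $B_R\Subset\Omega$ there is a sequence of functions $f_h:B_R\times\mathbb R^n\to[0,+\infty)$, $h\in\mathbb N$, of the form $$f_h(x,\xi)=\sum_{i=1}^{N_h}a_{i,h}(x)\,g_{i,h}(\xi),$$ where $a_{i,h}\in C^\infty(\mathbb R^n)$, $a_{i,h}\ge0$, $\sum_{i=1}^{N_h}a_{i,h}=1$ on $B_R$, and $g_{i,h}:\mathbb R^n\to[0,+\infty)$ is strictly convex, such that: (i) $f_h(x,\cdot)$ is strictly convex for every $x\in B_R$ and every $h$, and each $f_h$ satisfies (H1)–(H4) on $B_R$ with the same exponents $p,q$ and with the constants $m',M',K'$, independent of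 $h$, in place of $m,M,K$; (ii) $f_h\to f$ uniformly on $B_R\times C$ for every compact $C\subset\mathbb R^n$; (iii) there is a subsequence $(f_{h_k})$ such that for every $u\in W^{1,p}(B_R)$ with $f(\cdot,Du)\in L^1(B_R)$ one has $f_{h_k}(\cdot,Du)\in L^1(B_R)$ for every $k$ and $$\lim_{k\to\infty}\int_{B_R}f_{h_k}(x,Du(x))\,dx=\int_{B_R}f(x,Du(x))\,dx .$$ -/

import Mathlib

open MeasureTheory Filter Topology Set
open scoped ContDiff

namespace PQGrowth

/-- The Euclidean space `ℝⁿ`. -/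
abbrev E (n : ℕ) := EuclideanSpace ℝ (Fin n)

/-- `A` is the weak (distributional) derivative of `w` on the open set `Ω`:
both are locally integrable on `Ω` and
`∫_Ω (∂_v φ) w dx = - ∫_Ω φ (A v) dx` for all `φ ∈ C_c^∞(Ω)` and all directions `v`. -/
def HasWeakDerivOn {n : ℕ} {F : Type*} [NormedAddCommGroup F] [NormedSpace ℝ F]
    (w : E n → F) (A : E n → (E n →L[ℝ] F)) (Ω : Set (E n)) : Prop :=
  LocallyIntegrableOn w Ω volume ∧ LocallyIntegrableOn A Ω volume ∧
    ∀ φ : E n → ℝ, ContDiff ℝ ∞ φ → HasCompactSupport φ → tsupport φ ⊆ Ω → ∀ v : E n,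
      ∫ x in Ω, (fderiv ℝ φ x v) • w x = - ∫ x in Ω, φ x • A x v

/-- `u ∈ W^{1,p}(Ω)` with weak gradient `Du`. -/
def MemW1p {n : ℕ} (p : ℝ) (Ω : Set (E n)) (u : E n → ℝ) (Du : E n → E n) : Prop :=
  MemLp u (ENNReal.ofReal p) (volume.restrict Ω) ∧
    MemLp Du (ENNReal.ofReal p) (volume.restrict Ω) ∧
    HasWeakDerivOn u (fun x => innerSL ℝ (Du x)) Ω

/-- (H1): `f(x,·) ∈ C²(ℝⁿ)` for a.e. `x ∈ Ω`. -/
def H1 {n : ℕ} (Ω : Set (E n)) (f : E n → E n → ℝ) : Prop :=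
  ∀ᵐ x ∂(volume.restrict Ω), ContDiff ℝ 2 (f x)

/-- (H2): `m (1+|ξ|²)^{(p-2)/2} |v|² ≤ ∑ f_{ξᵢξⱼ}(x,ξ) vᵢ vⱼ`. -/
def H2 {n : ℕ} (p m : ℝ) (Ω : Set (E n)) (f : E n → E n → ℝ) : Prop :=
  ∀ᵐ x ∂(volume.restrict Ω), ∀ ξ v : E n,
    m * (1 + ‖ξ‖ ^ 2) ^ ((p - 2) / 2) * ‖v‖ ^ 2 ≤ fderiv ℝ (fderiv ℝ (f x)) ξ v v

/-- (H3): `|f_{ξξ}(x,ξ)| ≤ M (1+|ξ|²)^{(q-2)/2}`. -/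
def H3 {n : ℕ} (q M : ℝ) (Ω : Set (E n)) (f : E n → E n → ℝ) : Prop :=
  ∀ᵐ x ∂(volume.restrict Ω), ∀ ξ : E n,
    ‖fderiv ℝ (fderiv ℝ (f x)) ξ‖ ≤ M * (1 + ‖ξ‖ ^ 2) ^ ((q - 2) / 2)

/-- (H4): `|f_{ξx}(x,ξ)| ≤ K (1+|ξ|²)^{(q-1)/2}`, where `f_{ξx}(·,ξ)` is the weak derivative
in `x` of the map `x ↦ f_ξ(x,ξ)`. -/
def H4 {n : ℕ} (q K : ℝ) (Ω : Set (E n)) (f : E n → E n → ℝ) : Prop :=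
  ∃ fξx : E n → E n → (E n →L[ℝ] E n →L[ℝ] ℝ),
    (∀ ξ : E n, HasWeakDerivOn (fun x => fderiv ℝ (f x) ξ) (fun x => fξx x ξ) Ω) ∧
    ∀ᵐ x ∂(volume.restrict Ω), ∀ ξ : E n,
      ‖fξx x ξ‖ ≤ K * (1 + ‖ξ‖ ^ 2) ^ ((q - 1) / 2)

/-- (H5): there is a function `c(ε) ≥ 1` with `c(ε) → 1` as `ε → 0⁺` such that every ball
`B_ε(x) ⋐ Ω` has a point `y₀` in its closure with `f(y₀,ξ) ≤ c(ε) f(y,ξ)` for all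
`y ∈ B_ε(x)` and all `ξ`. -/
def H5 {n : ℕ} (Ω : Set (E n)) (f : E n → E n → ℝ) : Prop :=
  ∃ c : ℝ → ℝ, (∀ ε > 0, 1 ≤ c ε) ∧ Tendsto c (𝓝[>] 0) (𝓝 1) ∧
    ∀ ε > 0, ∀ x ∈ Ω, Metric.closedBall x ε ⊆ Ω →
      ∃ y₀ ∈ Metric.closedBall x ε, ∀ y ∈ Metric.ball x ε, ∀ ξ : E n, f y₀ ξ ≤ c ε * f y ξ

/-- (H6): `|f(x,ξ) - f(y,ξ)| ≤ H |x-y| (1+|ξ|²)^{q/2}` for all `x, y ∈ Ω` and all `ξ`. -/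
def H6 {n : ℕ} (q H : ℝ) (Ω : Set (E n)) (f : E n → E n → ℝ) : Prop :=
  ∀ x ∈ Ω, ∀ y ∈ Ω, ∀ ξ : E n,
    |f x ξ - f y ξ| ≤ H * ‖x - y‖ * (1 + ‖ξ‖ ^ 2) ^ (q / 2)

end PQGrowth

namespace PQGrowth

/-! At scale ε, take a partition of unity `a_k` on the ball, supported in balls of radius ε about
points `z_k`. Let `y_k` be the almost-minimum point that (H5) gives near `z_k`, and blend the frozen
integrands into `Σ a_k(x) f(y_k, ξ)`. Convex combinations preserve (H1)–(H3). For (H4), `Σ ∇a_k = 0`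
allows `f_ξ(y, ·)`, with `y` near `x`, to be subtracted from every factor in `Σ ∇a_k ⊗ f_ξ(y_k, ·)`.
The gradients cost 1/ε and the differences are of order `Kε(1+|ξ|²)^{(q-1)/2}`, so ε cancels. (H6)
gives uniform convergence on compact sets of `ξ`. (H5) gives `f_h ≤ 2f + 1`, so the energies
converge by domination although `(1+|Du|²)^{q/2}` need not be integrable.

The difficulty is that (H1)–(H4) hold only almost everywhere, and `y_k` may be exceptional. Good
points are dense, and between them `f_ξ` is Lipschitz in `x` (`exists_dense_regular_points`). One
good point near `y_k` is not enough: the error grows like `|ξ|^q`, while `f` is controlled from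
below only with exponent `p`. So `exists_regular_near` takes good points `x_N → y_k` and joins the
functions `f(x_N, ·)` by cutoffs across the shells `N ≤ |ξ|² < N+1`. Derivatives of the cutoffs
multiply only differences of values and gradients. Fast convergence therefore puts the error below
any positive continuous function of `ξ` (`exists_shellGlue_tolerance`), and second derivatives need
not be close to each other. `exists_approximation` combines this with `exists_grid_partition`. -/

/-! ### Weak derivatives -/

open scoped Convolution in
/-- A function with a bounded weak derivative is Lipschitz on a full-measure subset of a ball. -/
theorem HasWeakDerivOn.exists_lipschitz {n : ℕ} {F : Type*} [NormedAddCommGroup F]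
    [NormedSpace ℝ F] [FiniteDimensional ℝ F] {w : E n → F} {A : E n → (E n →L[ℝ] F)}
    {Ω : Set (E n)} (h : HasWeakDerivOn w A Ω) (hΩ : IsOpen Ω) {x₀ : E n} {r L : ℝ}
    (hB : Metric.closedBall x₀ r ⊆ Ω)
    (hA : ∀ᵐ x ∂(volume.restrict Ω), ‖A x‖ ≤ L) :
    ∃ G : Set (E n), (∀ᵐ x ∂(volume : Measure (E n)), x ∈ G) ∧
      ∀ x ∈ G, ∀ y ∈ G, x ∈ Metric.ball x₀ r → y ∈ Metric.ball x₀ r →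
        ‖w x - w y‖ ≤ L * ‖x - y‖ := by
  obtain ⟨hw, hAi, hparts⟩ := h
  have : CompleteSpace F := FiniteDimensional.complete ℝ F
  set B := Metric.ball x₀ r with hBdef
  set u : E n → F := B.indicator w with hu
  have hui : Integrable u volume := by
    rw [hu, integrable_indicator_iff Metric.isOpen_ball.measurableSet]
    exact (hw.integrableOn_compact_subset hB (isCompact_closedBall _ _)).mono_set
      Metric.ball_subset_closedBall
  let φ : ℕ → ContDiffBump (0 : E n) := fun k =>
    ⟨1 / ((k : ℝ) + 1), 2 * (1 / ((k : ℝ) + 1)), by positivity, by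
      have : (0 : ℝ) < 1 / ((k : ℝ) + 1) := by positivity
      linarith⟩
  have hφ0 : Tendsto (fun k => (φ k).rOut) atTop (𝓝 0) := by
    have := (tendsto_one_div_add_atTop_nhds_zero_nat (𝕜 := ℝ)).const_mul 2
    simpa [φ] using this
  have hconv := ContDiffBump.ae_convolution_tendsto_right_of_locallyIntegrable (μ := volume)
    (K := 2) hφ0 (Eventually.of_forall fun k => le_rfl) hui.locallyIntegrable
  refine ⟨_, hconv, fun x hx y hy hxB hyB => ?_⟩
  change Tendsto _ _ _ at hx hy
  have hux : u x = w x := indicator_of_mem hxB _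
  have huy : u y = w y := indicator_of_mem hyB _
  rw [hux] at hx
  rw [huy] at hy
  -- Both points lie in a strictly smaller ball, on which a mollifier of radius below `r - r'` sees
  -- only the ball of radius `r`. There the mollified function is `L`-Lipschitz, and the estimate
  -- passes to the limit at `x` and `y`.
  obtain ⟨r', hr'x, hr'⟩ := exists_between (max_lt (Metric.mem_ball.1 hxB) (Metric.mem_ball.1 hyB))
  rw [max_lt_iff] at hr'x
  refine le_of_tendsto (hx.sub hy).norm ?_
  filter_upwards [hφ0.eventually_lt_const (sub_pos.2 hr')] with k hk
  set ρ := (φ k).normed volume with hρ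
  have hρc : HasCompactSupport ρ := (φ k).hasCompactSupport_normed
  have hρs : ContDiff ℝ ∞ ρ := (φ k).contDiff_normed
  have hder : ∀ z : E n, HasFDerivAt (ρ ⋆[ContinuousLinearMap.lsmul ℝ ℝ, volume] u)
      ((fderiv ℝ ρ ⋆[(ContinuousLinearMap.lsmul ℝ ℝ).precompL (E n), volume] u) z) z := fun z =>
    hρc.hasFDerivAt_convolution_left _ (hρs.of_le (by simp)) hui.locallyIntegrable z
  have hbound : ∀ z ∈ Metric.ball x₀ r',
      ‖(fderiv ℝ ρ ⋆[(ContinuousLinearMap.lsmul ℝ ℝ).precompL (E n), volume] u) z‖ ≤ L := by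
    intro z hz
    have hL0 : 0 ≤ L := by
      have hne : (volume.restrict Ω) ≠ 0 := by
        rw [Ne, Measure.restrict_eq_zero]
        exact (hΩ.measure_pos volume ⟨x, hB (Metric.ball_subset_closedBall hxB)⟩).ne'
      have := ae_neBot.2 hne
      obtain ⟨t, ht⟩ := hA.exists
      exact (norm_nonneg _).trans ht
    refine ContinuousLinearMap.opNorm_le_bound _ hL0 fun v => ?_
    -- The reflected mollifier is an admissible test function; it turns the derivative of the
    -- convolution into an average of `A · v`.
    let θ : E n → ℝ := fun y => ρ (z - y)
    have hθs : ContDiff ℝ ∞ θ := hρs.comp (contDiff_const.sub contDiff_id)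
    have hθsupp : tsupport θ ⊆ Metric.ball x₀ r := by
      have h1 : tsupport θ ⊆ Metric.closedBall z (φ k).rOut := by
        refine closure_minimal (fun y hy => ?_) Metric.isClosed_closedBall
        have : z - y ∈ Function.support ρ := hy
        rw [hρ, ContDiffBump.support_normed_eq] at this
        rw [Metric.mem_closedBall, dist_comm, dist_eq_norm]
        simpa using (mem_ball_zero_iff.1 this).le
      refine h1.trans fun y hy => ?_
      rw [Metric.mem_ball]
      have h2 := dist_triangle y z x₀
      have h3 := Metric.mem_closedBall.1 hy
      have h4 := Metric.mem_ball.1 hz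
      linarith
    have hθc : HasCompactSupport θ :=
      (isCompact_closedBall x₀ r).of_isClosed_subset (isClosed_tsupport _)
        (hθsupp.trans Metric.ball_subset_closedBall)
    have hθd : ∀ y, fderiv ℝ θ y v = - fderiv ℝ ρ (z - y) v := by
      intro y
      have : HasFDerivAt θ ((fderiv ℝ ρ (z - y)).comp (-(ContinuousLinearMap.id ℝ (E n)))) y :=
        ((hρs.differentiable (by simp)) _).hasFDerivAt.comp y
          ((hasFDerivAt_id y).const_sub z)
      rw [this.fderiv]
      simp
    have hkey := hparts θ hθs hθc
      (hθsupp.trans (Metric.ball_subset_closedBall.trans hB)) v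
    have hBΩ : B ⊆ Ω := Metric.ball_subset_closedBall.trans hB
    have hval : (fderiv ℝ ρ ⋆[(ContinuousLinearMap.lsmul ℝ ℝ).precompL (E n), volume] u) z v
        = ∫ x in Ω, θ x • A x v := by
      rw [← neg_eq_iff_eq_neg] at hkey
      rw [← hkey, ← MeasureTheory.convolution_flip, convolution_def,
        ContinuousLinearMap.integral_apply]
      · rw [← integral_neg, ← integral_indicator hΩ.measurableSet]
        congr 1
        ext y
        simp only [ContinuousLinearMap.flip_apply, ContinuousLinearMap.precompL_apply,
          ContinuousLinearMap.lsmul_apply]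
        by_cases hyB : y ∈ B
        · rw [indicator_of_mem (hBΩ hyB), hθd, hu, indicator_of_mem hyB]; simp
        · have h0 : fderiv ℝ θ y = 0 := by
            by_contra hne
            exact hyB (hθsupp (support_fderiv_subset ℝ hne))
          have h1 : fderiv ℝ ρ (z - y) v = 0 := by
            have := hθd y
            rw [h0] at this
            simpa using this.symm
          rw [h1]
          by_cases hyΩ : y ∈ Ω
          · rw [indicator_of_mem hyΩ, h0]; simp
          · rw [indicator_of_notMem hyΩ]; simp
      · have := (hρc.fderiv ℝ).convolutionExists_left
          ((ContinuousLinearMap.lsmul ℝ ℝ (E := F)).precompL (E n))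
          (hρs.continuous_fderiv (by simp)) hui.locallyIntegrable z
        exact this.integrable_swap
    rw [hval]
    have hθint : Integrable θ volume := hθs.continuous.integrable_of_hasCompactSupport hθc
    have hθ0 : ∀ y, 0 ≤ θ y := fun y => (φ k).nonneg_normed _
    calc ‖∫ x in Ω, θ x • A x v‖ ≤ ∫ x in Ω, θ x * (L * ‖v‖) := by
          refine norm_integral_le_of_norm_le (hθint.integrableOn.mul_const _) ?_
          filter_upwards [hA] with t ht
          rw [norm_smul, Real.norm_of_nonneg (hθ0 t)]
          exact mul_le_mul_of_nonneg_left (((A t).le_opNorm v).trans (by gcongr)) (hθ0 t)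
      _ = (∫ x in Ω, θ x) * (L * ‖v‖) := integral_mul_const _ _
      _ ≤ 1 * (L * ‖v‖) := by
          gcongr
          calc ∫ x in Ω, θ x ≤ ∫ x, θ x :=
                setIntegral_le_integral hθint (Eventually.of_forall hθ0)
            _ = ∫ x, ρ x := integral_sub_left_eq_self ρ volume z
            _ = 1 := (φ k).integral_normed
            _ ≤ 1 := le_rfl
      _ = L * ‖v‖ := one_mul _
  exact (convex_ball x₀ r').norm_image_sub_le_of_norm_hasFDerivWithin_le
    (fun z _ => (hder z).hasFDerivWithinAt) hbound hr'x.2 hr'x.1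

/-- The classical derivative of a smooth function is its weak derivative. -/
theorem hasWeakDerivOn_of_contDiff {n : ℕ} {F : Type*} [NormedAddCommGroup F]
    [NormedSpace ℝ F] [FiniteDimensional ℝ F] {w : E n → F} (hw : ContDiff ℝ 1 w)
    {Ω : Set (E n)} :
    HasWeakDerivOn w (fun x => fderiv ℝ w x) Ω := by
  refine ⟨hw.continuous.locallyIntegrable.locallyIntegrableOn _,
    (hw.continuous_fderiv (by simp)).locallyIntegrable.locallyIntegrableOn _, ?_⟩
  intro φ hφ hφc hφΩ v
  have hsub : Function.support φ ⊆ Ω := (subset_tsupport φ).trans hφΩ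
  have h1 : Continuous fun x => fderiv ℝ φ x v := (hφ.continuous_fderiv (by simp)).clm_apply
    continuous_const
  have h2 : Continuous fun x => fderiv ℝ w x v := (hw.continuous_fderiv (by simp)).clm_apply
    continuous_const
  have hc1 : HasCompactSupport fun x => fderiv ℝ φ x v := hφc.fderiv_apply ℝ v
  rw [setIntegral_eq_integral_of_forall_compl_eq_zero, setIntegral_eq_integral_of_forall_compl_eq_zero]
  · rw [integral_smul_fderiv_eq_neg_fderiv_smul_of_integrable, neg_neg]
    · exact (h1.smul hw.continuous).integrable_of_hasCompactSupport hc1.smul_right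
    · exact (hφ.continuous.smul h2).integrable_of_hasCompactSupport hφc.smul_right
    · exact (hφ.continuous.smul hw.continuous).integrable_of_hasCompactSupport hφc.smul_right
    · exact fun x _ => hφ.differentiable (by simp) x
    · exact fun x _ => hw.differentiable (by simp) x
  · intro x hx
    have : φ x = 0 := by
      by_contra hne
      exact hx (hsub hne)
    simp [this]
  · intro x hx
    have : fderiv ℝ φ x = 0 := by
      by_contra hne
      exact hx (hφΩ (support_fderiv_subset ℝ hne))
    simp [this]

/-! ### Strict convexity from the second derivative -/

/-- A `C²` function with positive definite second derivative is strictly convex. -/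
theorem strictConvexOn_of_fderiv_fderiv_pos {V : Type*} [NormedAddCommGroup V] [NormedSpace ℝ V]
    {g : V → ℝ} (hg : ContDiff ℝ 2 g)
    (hpos : ∀ ξ v : V, v ≠ 0 → 0 < fderiv ℝ (fderiv ℝ g) ξ v v) :
    StrictConvexOn ℝ univ g := by
  refine ⟨convex_univ, fun x _ y _ hxy a b ha hb hab => ?_⟩
  have hline : ∀ t : ℝ, HasDerivAt (fun t : ℝ => x + t • (y - x)) (y - x) t := fun t => by
    simpa using ((hasDerivAt_id t).smul_const (y - x)).const_add x
  have hd1 : ∀ t : ℝ, HasDerivAt (fun t : ℝ => g (x + t • (y - x)))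
      (fderiv ℝ g (x + t • (y - x)) (y - x)) t := fun t =>
    ((hg.differentiable (by simp)) _).hasFDerivAt.comp_hasDerivAt t (hline t)
  have hg' : ContDiff ℝ 1 (fderiv ℝ g) := hg.fderiv_right (by norm_num)
  have hd2 : ∀ t : ℝ, HasDerivAt (fun t : ℝ => fderiv ℝ g (x + t • (y - x)) (y - x))
      (fderiv ℝ (fderiv ℝ g) (x + t • (y - x)) (y - x) (y - x)) t := fun t => by
    have := (((hg'.differentiable (by simp)) _).hasFDerivAt.comp_hasDerivAt t (hline t))
    simpa using this.clm_apply (hasDerivAt_const t (y - x))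
  have hderiv : deriv (fun t : ℝ => g (x + t • (y - x))) =
      fun t => fderiv ℝ g (x + t • (y - x)) (y - x) := funext fun t => (hd1 t).deriv
  have hsc : StrictConvexOn ℝ univ (fun t : ℝ => g (x + t • (y - x))) := by
    refine strictConvexOn_of_deriv2_pos convex_univ
      (fun t _ => (hd1 t).continuousAt.continuousWithinAt) fun t _ => ?_
    rw [Function.iterate_succ, Function.iterate_one, Function.comp_apply, hderiv, (hd2 t).deriv]
    exact hpos _ _ (sub_ne_zero.2 hxy.symm)
  have := hsc.2 (mem_univ 0) (mem_univ 1) zero_ne_one ha hb hab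
  have e : x + b • (y - x) = a • x + b • y := by
    rw [← eq_sub_iff_add_eq] at hab
    rw [hab]; module
  simpa [e] using this

/-! ### Gluing a sequence of functions across shells in ξ -/

/-- A smooth radial cutoff: `0` where `‖ξ‖² ≤ N + 1/3` and `1` where `N + 2/3 ≤ ‖ξ‖²`. -/
noncomputable def shellCutoff {n : ℕ} (N : ℕ) (ξ : E n) : ℝ :=
  Real.smoothTransition (3 * (‖ξ‖ ^ 2 - N) - 1)

theorem shellCutoff_contDiff {n : ℕ} (N : ℕ) : ContDiff ℝ 2 (shellCutoff (n := n) N) := by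
  unfold shellCutoff
  exact Real.smoothTransition.contDiff.comp
    ((contDiff_const.mul ((contDiff_norm_sq ℝ).sub contDiff_const)).sub contDiff_const)

theorem shellCutoff_nonneg {n : ℕ} (N : ℕ) (ξ : E n) : 0 ≤ shellCutoff N ξ :=
  Real.smoothTransition.nonneg _

theorem shellCutoff_le_one {n : ℕ} (N : ℕ) (ξ : E n) : shellCutoff N ξ ≤ 1 :=
  Real.smoothTransition.le_one _

/-- Two consecutive terms of a sequence of functions, joined by the cutoff. -/
noncomputable def shellBlend {n : ℕ} (φ : ℕ → E n → ℝ) (N : ℕ) (ξ : E n) : ℝ :=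
  φ N ξ + shellCutoff N ξ * (φ (N + 1) ξ - φ N ξ)

/-- The function that is close to `φ N` on the shell `N ≤ ‖ξ‖² < N + 1`. -/
noncomputable def shellGlue {n : ℕ} (φ : ℕ → E n → ℝ) (ξ : E n) : ℝ :=
  shellBlend φ ⌊‖ξ‖ ^ 2⌋₊ ξ

/-- The only danger is the jump of the floor at `‖ξ‖² = N`. Just below it the previous cutoff is
already 1, just above it the next one is still 0, so both blends equal `φ N` there. Smoothness and
derivatives of the glued function are thus those of one blend. -/
theorem shellGlue_eventuallyEq {n : ℕ} (φ : ℕ → E n → ℝ) (ξ : E n) :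
    shellGlue φ =ᶠ[𝓝 ξ] shellBlend φ ⌊‖ξ‖ ^ 2⌋₊ := by
  set N := ⌊‖ξ‖ ^ 2⌋₊ with hN
  have h1 : (N : ℝ) ≤ ‖ξ‖ ^ 2 := Nat.floor_le (by positivity)
  have h2 : ‖ξ‖ ^ 2 < N + 1 := Nat.lt_floor_add_one _
  have hc : Continuous fun η : E n => ‖η‖ ^ 2 := by fun_prop
  filter_upwards [hc.continuousAt.eventually_lt_const h2,
    hc.continuousAt.eventually_const_lt (show (N : ℝ) - 1 / 3 < ‖ξ‖ ^ 2 by linarith)] with η hη1 hη2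
  by_cases hη : (N : ℝ) ≤ ‖η‖ ^ 2
  · rw [shellGlue, show ⌊‖η‖ ^ 2⌋₊ = N from (Nat.floor_eq_iff (by positivity)).2 ⟨hη, hη1⟩]
  · push Not at hη
    obtain ⟨k, hk⟩ : ∃ k, N = k + 1 := by
      refine Nat.exists_eq_succ_of_ne_zero fun h0 => ?_
      rw [h0] at hη
      have : 0 ≤ ‖η‖ ^ 2 := by positivity
      simp at hη
      linarith
    rw [hk] at hη hη2 ⊢
    push_cast at hη hη2
    rw [shellGlue, show ⌊‖η‖ ^ 2⌋₊ = k from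
      (Nat.floor_eq_iff (by positivity)).2 ⟨by linarith, hη⟩]
    have e1 : shellCutoff k η = 1 := Real.smoothTransition.one_of_one_le (by linarith)
    have e2 : shellCutoff (k + 1) η = 0 :=
      Real.smoothTransition.zero_of_nonpos (by push_cast; linarith)
    simp [shellBlend, e1, e2]

theorem shellBlend_contDiff {n : ℕ} {φ : ℕ → E n → ℝ} (hφ : ∀ k, ContDiff ℝ 2 (φ k)) (N : ℕ) :
    ContDiff ℝ 2 (shellBlend φ N) :=
  (hφ N).add ((shellCutoff_contDiff N).mul
    ((hφ (N + 1)).sub (hφ N)))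

theorem shellGlue_contDiff {n : ℕ} {φ : ℕ → E n → ℝ} (hφ : ∀ k, ContDiff ℝ 2 (φ k)) :
    ContDiff ℝ 2 (shellGlue φ) :=
  contDiff_iff_contDiffAt.2 fun ξ =>
    (shellBlend_contDiff hφ _).contDiffAt.congr_of_eventuallyEq (shellGlue_eventuallyEq φ ξ)

theorem hasFDerivAt_shellBlend {n : ℕ} {φ : ℕ → E n → ℝ} (hφ : ∀ k, ContDiff ℝ 2 (φ k)) (N : ℕ)
    (ξ : E n) :
    HasFDerivAt (shellBlend φ N) (fderiv ℝ (φ N) ξ +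
      (shellCutoff N ξ • (fderiv ℝ (φ (N + 1)) ξ - fderiv ℝ (φ N) ξ) +
        (φ (N + 1) ξ - φ N ξ) • fderiv ℝ (shellCutoff N) ξ)) ξ := by
  have hd : ∀ k, HasFDerivAt (φ k) (fderiv ℝ (φ k) ξ) ξ := fun k =>
    ((hφ k).differentiable (by simp) ξ).hasFDerivAt
  have hs : HasFDerivAt (shellCutoff N) (fderiv ℝ (shellCutoff N) ξ) ξ :=
    ((shellCutoff_contDiff N).differentiable (by simp) ξ).hasFDerivAt
  exact (hd N).add (hs.mul ((hd (N + 1)).sub (hd N)))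

/-- Second derivatives of the `φ k` enter only through a convex combination; all other terms carry
differences of values or of gradients, which can be made small. -/
theorem hasFDerivAt_fderiv_shellBlend {n : ℕ} {φ : ℕ → E n → ℝ} (hφ : ∀ k, ContDiff ℝ 2 (φ k))
    (N : ℕ) (ξ : E n) :
    HasFDerivAt (fderiv ℝ (shellBlend φ N)) (fderiv ℝ (fderiv ℝ (φ N)) ξ +
      ((shellCutoff N ξ • (fderiv ℝ (fderiv ℝ (φ (N + 1))) ξ - fderiv ℝ (fderiv ℝ (φ N)) ξ) +
        (fderiv ℝ (shellCutoff N) ξ).smulRight (fderiv ℝ (φ (N + 1)) ξ - fderiv ℝ (φ N) ξ)) +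
        ((φ (N + 1) ξ - φ N ξ) • fderiv ℝ (fderiv ℝ (shellCutoff N)) ξ +
        (fderiv ℝ (φ (N + 1)) ξ - fderiv ℝ (φ N) ξ).smulRight (fderiv ℝ (shellCutoff N) ξ)))) ξ := by
  have hd : ∀ k, HasFDerivAt (φ k) (fderiv ℝ (φ k) ξ) ξ := fun k =>
    ((hφ k).differentiable (by simp) ξ).hasFDerivAt
  have hd' : ∀ k, HasFDerivAt (fderiv ℝ (φ k)) (fderiv ℝ (fderiv ℝ (φ k)) ξ) ξ := fun k =>
    (((hφ k).fderiv_right (m := 1) (by norm_num)).differentiable (by simp) ξ).hasFDerivAt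
  have hs : HasFDerivAt (shellCutoff N) (fderiv ℝ (shellCutoff N) ξ) ξ :=
    ((shellCutoff_contDiff N).differentiable (by simp) ξ).hasFDerivAt
  have hs' : HasFDerivAt (fderiv ℝ (shellCutoff N)) (fderiv ℝ (fderiv ℝ (shellCutoff N)) ξ) ξ :=
    (((shellCutoff_contDiff N).fderiv_right (m := 1) (by norm_num)).differentiable
      (by simp) ξ).hasFDerivAt
  rw [show fderiv ℝ (shellBlend φ N) = _ from
    funext fun η => (hasFDerivAt_shellBlend hφ N η).fderiv]
  exact (hd' N).add ((hs.smul ((hd' (N + 1)).sub (hd' N))).add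
    (((hd (N + 1)).sub (hd N)).smul hs'))

/-- Bounds for the derivatives of the cutoff on a shell. -/
theorem exists_shellCutoff_bound {n : ℕ} (N : ℕ) : ∃ C : ℝ, 0 ≤ C ∧ ∀ ξ : E n, ‖ξ‖ ^ 2 ≤ N + 1 →
    ‖fderiv ℝ (shellCutoff N) ξ‖ ≤ C ∧ ‖fderiv ℝ (fderiv ℝ (shellCutoff N)) ξ‖ ≤ C := by
  have hs : ContDiff ℝ 1 (fderiv ℝ (shellCutoff (n := n) N)) :=
    (shellCutoff_contDiff N).fderiv_right (m := 1) (by norm_num)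
  obtain ⟨C₁, hC₁⟩ := (isCompact_closedBall (0 : E n) ((N : ℝ) + 1)).exists_bound_of_continuousOn
    hs.continuous.continuousOn
  obtain ⟨C₂, hC₂⟩ := (isCompact_closedBall (0 : E n) ((N : ℝ) + 1)).exists_bound_of_continuousOn
    (hs.continuous_fderiv (by simp)).continuousOn
  refine ⟨max 0 (max C₁ C₂), le_max_left _ _, fun ξ hξ => ?_⟩
  have hmem : ξ ∈ Metric.closedBall (0 : E n) ((N : ℝ) + 1) := by
    rw [mem_closedBall_zero_iff]
    nlinarith [norm_nonneg ξ, (Nat.cast_nonneg N : (0 : ℝ) ≤ N)]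
  exact ⟨(hC₁ ξ hmem).trans ((le_max_left _ _).trans (le_max_right _ _)),
    (hC₂ ξ hmem).trans ((le_max_right _ _).trans (le_max_right _ _))⟩

/-- If `φ k → ψ` fast enough, then the glued function is as close to `ψ` as desired, and its first
two derivatives are convex combinations of those of the `φ k`, up to a small error. -/
theorem exists_shellGlue_tolerance {n : ℕ} (e : E n → ℝ) (he : Continuous e) (hpos : ∀ ξ, 0 < e ξ) :
    ∃ δ : ℕ → ℝ, (∀ N, 0 < δ N) ∧ ∀ (φ : ℕ → E n → ℝ) (ψ : E n → ℝ),
      (∀ k, ContDiff ℝ 2 (φ k)) →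
      (∀ (N : ℕ) (ξ : E n), ‖ξ‖ ^ 2 ≤ N + 1 → |φ N ξ - ψ ξ| ≤ δ N ∧ |φ (N + 1) ξ - ψ ξ| ≤ δ N ∧
        ‖fderiv ℝ (φ (N + 1)) ξ - fderiv ℝ (φ N) ξ‖ ≤ δ N) →
      ∀ ξ, ∃ N, ∃ t ∈ Icc (0 : ℝ) 1,
        shellGlue φ ξ = (1 - t) * φ N ξ + t * φ (N + 1) ξ ∧
        |shellGlue φ ξ - ψ ξ| ≤ e ξ ∧
        ‖fderiv ℝ (shellGlue φ) ξ -
          ((1 - t) • fderiv ℝ (φ N) ξ + t • fderiv ℝ (φ (N + 1)) ξ)‖ ≤ e ξ ∧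
        ‖fderiv ℝ (fderiv ℝ (shellGlue φ)) ξ - ((1 - t) • fderiv ℝ (fderiv ℝ (φ N)) ξ +
          t • fderiv ℝ (fderiv ℝ (φ (N + 1))) ξ)‖ ≤ e ξ := by
  have hmin : ∀ N : ℕ, ∃ c : ℝ, 0 < c ∧ ∀ ξ : E n, ‖ξ‖ ^ 2 ≤ N + 1 → c ≤ e ξ := by
    intro N
    obtain ⟨ξ₀, -, h0⟩ := (isCompact_closedBall (0 : E n) ((N : ℝ) + 1)).exists_isMinOn
      ⟨0, by simp; positivity⟩ he.continuousOn
    refine ⟨e ξ₀, hpos _, fun ξ hξ => h0 ?_⟩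
    rw [mem_closedBall_zero_iff]
    nlinarith [norm_nonneg ξ, (Nat.cast_nonneg N : (0 : ℝ) ≤ N)]
  choose c hc0 hc using hmin
  choose C hC0 hC using fun N => exists_shellCutoff_bound (n := n) N
  -- The worst error is in the second derivative: two gradient terms of size `C δ` and one value
  -- term of size `2 C δ`. The extra 1 covers the value estimate and avoids division by zero.
  refine ⟨fun N => c N / (4 * C N + 1), fun N => div_pos (hc0 N) (by linarith [hC0 N]), ?_⟩
  intro φ ψ hφ hclose ξ
  set N := ⌊‖ξ‖ ^ 2⌋₊ with hN
  have hξN : ‖ξ‖ ^ 2 ≤ N + 1 := (Nat.lt_floor_add_one _).le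
  obtain ⟨h1, h2, h3⟩ := hclose N ξ hξN
  obtain ⟨hCa, hCb⟩ := hC N ξ hξN
  have hce := hc N ξ hξN
  set δ := c N / (4 * C N + 1) with hδ
  have hC0' := hC0 N
  have hδ0 : 0 < δ := div_pos (hc0 N) (by linarith)
  have hδe : δ * (4 * C N + 1) = c N := div_mul_cancel₀ _ (by linarith)
  set t := shellCutoff N ξ with ht
  have ht0 : 0 ≤ t := shellCutoff_nonneg N ξ
  have ht1 : t ≤ 1 := shellCutoff_le_one N ξ
  have hd : |φ (N + 1) ξ - φ N ξ| ≤ 2 * δ := by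
    rw [abs_le] at *
    constructor <;> linarith [h1.1, h1.2, h2.1, h2.2]
  have heq := shellGlue_eventuallyEq φ ξ
  have hval : shellGlue φ ξ = (1 - t) * φ N ξ + t * φ (N + 1) ξ := by
    rw [heq.eq_of_nhds, shellBlend]; ring
  refine ⟨N, t, ⟨ht0, ht1⟩, hval, ?_, ?_, ?_⟩
  · rw [hval, show (1 - t) * φ N ξ + t * φ (N + 1) ξ - ψ ξ =
      (1 - t) * (φ N ξ - ψ ξ) + t * (φ (N + 1) ξ - ψ ξ) by ring]
    have hδc : δ ≤ c N := by nlinarith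
    refine (abs_add_le _ _).trans ?_
    rw [abs_mul, abs_mul, abs_of_nonneg ht0, abs_of_nonneg (sub_nonneg.2 ht1)]
    nlinarith
  · rw [heq.fderiv_eq, (hasFDerivAt_shellBlend hφ N ξ).fderiv]
    rw [show ∀ a b d : E n →L[ℝ] ℝ, a + (t • (b - a) + d) - ((1 - t) • a + t • b) = d from
      fun a b d => by module]
    rw [norm_smul, Real.norm_eq_abs]
    nlinarith [mul_le_mul hd hCa (norm_nonneg _) (by linarith)]
  · rw [heq.fderiv.fderiv_eq, (hasFDerivAt_fderiv_shellBlend hφ N ξ).fderiv]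
    rw [show ∀ a b d d' : E n →L[ℝ] E n →L[ℝ] ℝ,
      a + ((t • (b - a) + d) + d') - ((1 - t) • a + t • b) = d + d' from
      fun a b d d' => by module]
    have htri : ∀ a b d : E n →L[ℝ] E n →L[ℝ] ℝ, ‖a + (b + d)‖ ≤ ‖a‖ + (‖b‖ + ‖d‖) :=
      fun a b d => (norm_add_le a (b + d)).trans (add_le_add le_rfl (norm_add_le b d))
    refine (htri _ _ _).trans ?_
    rw [ContinuousLinearMap.norm_smulRight_apply, ContinuousLinearMap.norm_smulRight_apply]
    have hsmul : ‖(φ (N + 1) ξ - φ N ξ) • fderiv ℝ (fderiv ℝ (shellCutoff N)) ξ‖ ≤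
        |φ (N + 1) ξ - φ N ξ| * ‖fderiv ℝ (fderiv ℝ (shellCutoff N)) ξ‖ :=
      ContinuousLinearMap.opNorm_smul_le _ _
    nlinarith [mul_le_mul hd hCb (ContinuousLinearMap.opNorm_nonneg _) (by linarith),
      mul_le_mul h3 hCa (norm_nonneg _) hδ0.le]

/-! ### Grid partitions of unity -/

/-- A smooth bump supported in `[-1, 1]` whose integer translates sum to `1`. -/
noncomputable def unitBump (t : ℝ) : ℝ :=
  Real.smoothTransition (t + 1) - Real.smoothTransition t

theorem unitBump_contDiff : ContDiff ℝ ∞ unitBump :=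
  (Real.smoothTransition.contDiff.comp (contDiff_id.add contDiff_const)).sub
    Real.smoothTransition.contDiff

theorem unitBump_nonneg (t : ℝ) : 0 ≤ unitBump t := by
  unfold unitBump
  rcases le_or_gt t 0 with h | h
  · rw [Real.smoothTransition.zero_of_nonpos h]
    simpa using Real.smoothTransition.nonneg _
  · rw [Real.smoothTransition.one_of_one_le (by linarith : 1 ≤ t + 1)]
    simpa using Real.smoothTransition.le_one _

theorem unitBump_le_one (t : ℝ) : unitBump t ≤ 1 := by
  unfold unitBump
  linarith [Real.smoothTransition.le_one (t + 1), Real.smoothTransition.nonneg t]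

theorem abs_le_one_of_unitBump_ne_zero {t : ℝ} (h : unitBump t ≠ 0) : |t| ≤ 1 := by
  contrapose! h
  unfold unitBump
  rcases lt_abs.1 h with h | h
  · rw [Real.smoothTransition.one_of_one_le h.le,
      Real.smoothTransition.one_of_one_le (by linarith : 1 ≤ t + 1), sub_self]
  · rw [Real.smoothTransition.zero_of_nonpos (by linarith : t ≤ 0),
      Real.smoothTransition.zero_of_nonpos (by linarith : t + 1 ≤ 0), sub_self]

theorem exists_deriv_unitBump_bound : ∃ C : ℝ, 0 < C ∧ ∀ t, |deriv unitBump t| ≤ C := by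
  have hc : HasCompactSupport unitBump :=
    HasCompactSupport.of_support_subset_isCompact (isCompact_Icc (a := (-1 : ℝ)) (b := 1))
      fun t ht => abs_le.1 (abs_le_one_of_unitBump_ne_zero ht)
  obtain ⟨C, hC⟩ := hc.deriv.exists_bound_of_continuous
    (unitBump_contDiff.continuous_deriv (by simp))
  exact ⟨max C 1, by positivity, fun t => (hC t).trans (le_max_left _ _)⟩

/-- The sum telescopes; the bounds on `u` put the first end at 1 and the last at 0. -/
theorem sum_range_unitBump {u : ℝ} {m : ℕ} (h0 : 0 ≤ u) (hm : u + 1 ≤ m) :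
    ∑ k ∈ Finset.range m, unitBump (u - k) = 1 := by
  have := Finset.sum_range_sub' (fun k : ℕ => Real.smoothTransition (u + 1 - k)) m
  rw [Real.smoothTransition.one_of_one_le (by simpa using h0 : 1 ≤ u + 1 - ((0 : ℕ) : ℝ)),
    Real.smoothTransition.zero_of_nonpos (by linarith : u + 1 - m ≤ 0), sub_zero] at this
  rw [← this]
  refine Finset.sum_congr rfl fun k _ => ?_
  unfold unitBump
  push_cast
  ring_nf

/-- A bump attached to the multi-index `k` of a grid of mesh `s`, shifted by `L`. -/
noncomputable def gridBump {n : ℕ} (s L : ℝ) (k : Fin n → ℕ) (x : E n) : ℝ :=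
  ∏ j, unitBump (x j / s + L - k j)

theorem contDiff_gridBump {n : ℕ} (s L : ℝ) (k : Fin n → ℕ) : ContDiff ℝ ∞ (gridBump s L k) := by
  unfold gridBump
  refine contDiff_prod fun j _ => unitBump_contDiff.comp ?_
  exact (((EuclideanSpace.proj (𝕜 := ℝ) j).contDiff.div_const s).add contDiff_const).sub
    contDiff_const

theorem gridBump_nonneg {n : ℕ} (s L : ℝ) (k : Fin n → ℕ) (x : E n) : 0 ≤ gridBump s L k x :=
  Finset.prod_nonneg fun _ _ => unitBump_nonneg _

theorem tsupport_gridBump_subset {n : ℕ} (s L : ℝ) (k : Fin n → ℕ) :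
    tsupport (gridBump s L k) ⊆ {x : E n | ∀ j, |x j / s + L - k j| ≤ 1} := by
  refine closure_minimal (fun x hx j => ?_) ?_
  · exact abs_le_one_of_unitBump_ne_zero (Finset.prod_ne_zero_iff.1 hx j (Finset.mem_univ _))
  · rw [Set.ofPred_forall]
    refine isClosed_iInter fun j => isClosed_le ?_ continuous_const
    fun_prop

/-- The product rule gives `n` terms, each with one differentiated factor costing `C / s` and the
others at most 1. -/
theorem norm_fderiv_gridBump_le {n : ℕ} {s : ℝ} (hs : 0 < s) (L : ℝ) (k : Fin n → ℕ) {C : ℝ}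
    (hC : ∀ t, |deriv unitBump t| ≤ C) (x : E n) :
    ‖fderiv ℝ (gridBump s L k) x‖ ≤ n * (C / s) := by
  have hd : ∀ j ∈ (Finset.univ : Finset (Fin n)),
      HasFDerivAt (fun x : E n => unitBump (x j / s + L - k j))
        (deriv unitBump (x j / s + L - k j) • s⁻¹ • EuclideanSpace.proj (𝕜 := ℝ) j) x := by
    intro j _
    have h1 : HasFDerivAt (fun x : E n => x j / s + L - k j)
        (s⁻¹ • (EuclideanSpace.proj (𝕜 := ℝ) j : E n →L[ℝ] ℝ)) x := by
      have := (((EuclideanSpace.proj (𝕜 := ℝ) j : E n →L[ℝ] ℝ).hasFDerivAt (x := x)).const_mul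
        s⁻¹).add_const L |>.sub_const (k j : ℝ)
      refine this.congr_of_eventuallyEq (Eventually.of_forall fun y => ?_)
      simp [div_eq_inv_mul]
    exact ((unitBump_contDiff.differentiable (by simp)) _).hasDerivAt.comp_hasFDerivAt x h1
  have hprod := HasFDerivAt.finsetProd hd
  have : fderiv ℝ (gridBump s L k) x = _ := hprod.fderiv
  rw [this]
  refine (norm_sum_le _ _).trans ?_
  rw [show (n : ℝ) * (C / s) = ∑ j : Fin n, C / s by simp]
  refine Finset.sum_le_sum fun j _ => ?_
  have hp : |∏ i ∈ Finset.univ.erase j, unitBump (x i / s + L - k i)| ≤ 1 := by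
    rw [abs_of_nonneg (Finset.prod_nonneg fun _ _ => unitBump_nonneg _)]
    exact Finset.prod_le_one (fun _ _ => unitBump_nonneg _) fun _ _ => unitBump_le_one _
  have hproj : ‖(EuclideanSpace.proj (𝕜 := ℝ) j : E n →L[ℝ] ℝ)‖ ≤ 1 :=
    ContinuousLinearMap.opNorm_le_bound _ zero_le_one fun v => by
      simpa using PiLp.norm_apply_le v j
  have hC0 : 0 ≤ C := (abs_nonneg _).trans (hC 0)
  rw [norm_smul, norm_smul, norm_smul, Real.norm_eq_abs, Real.norm_eq_abs, Real.norm_eq_abs,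
    abs_of_pos (inv_pos.2 hs)]
  calc _ ≤ 1 * (C * (s⁻¹ * 1)) := by
        gcongr
        exact hC _
    _ = C / s := by ring

/-- A smooth partition of unity on a ball, subordinate to balls of radius `(n + 1) s`, with the
gradients summing to at most a constant over `s`. -/
theorem exists_grid_partition (n : ℕ) : ∃ C : ℝ, 0 < C ∧ ∀ (x₀ : E n) (R s : ℝ), 0 < s →
    ∃ (T : Finset (Fin n → ℕ)) (a : (Fin n → ℕ) → E n → ℝ) (z : (Fin n → ℕ) → E n),
      (∀ k, ContDiff ℝ ∞ (a k)) ∧ (∀ k x, 0 ≤ a k x) ∧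
      (∀ k x, x ∈ tsupport (a k) → ‖x - z k‖ < (n + 1) * s) ∧
      ∀ x ∈ Metric.ball x₀ R, ∑ k ∈ T, a k x = 1 ∧ ∑ k ∈ T, ‖fderiv ℝ (a k) x‖ ≤ C / s := by
  obtain ⟨C, hC0, hC⟩ := exists_deriv_unitBump_bound
  -- At most `3 ^ n` bumps have nonzero gradient at a point, each of size at most `n C / s`; `n + 1`
  -- keeps the constant positive for `n = 0`.
  refine ⟨3 ^ n * ((n + 1) * C), by positivity, fun x₀ R s hs => ?_⟩
  -- The shift by `L` makes all rescaled coordinates on the ball nonnegative, so natural-number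
  -- indices suffice.
  obtain ⟨L, hL⟩ := exists_nat_ge ((‖x₀‖ + R) / s)
  refine ⟨Fintype.piFinset fun _ => Finset.range (2 * L + 1), gridBump s L,
    fun k => WithLp.toLp 2 fun j => s * (k j - L), contDiff_gridBump s L, gridBump_nonneg s L,
    fun k x hx => ?_, fun x hx => ?_⟩
  · have hx' := tsupport_gridBump_subset s L k hx
    have hcoord : ∀ j, |x j - s * (k j - L)| ≤ s := fun j => by
      have h1 : x j - s * (k j - L) = s * (x j / s + L - k j) := by
        field_simp
        ring
      rw [h1, abs_mul, abs_of_pos hs]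
      exact mul_le_of_le_one_right hs.le (hx' j)
    have hle : ‖x - WithLp.toLp 2 fun j => s * ((k j : ℝ) - L)‖ ≤ n * s := by
      rw [EuclideanSpace.norm_eq]
      refine Real.sqrt_le_iff.2 ⟨by positivity, ?_⟩
      calc ∑ j, ‖(x - WithLp.toLp 2 fun j => s * ((k j : ℝ) - L)) j‖ ^ 2 ≤ ∑ _j : Fin n, s ^ 2 := by
            refine Finset.sum_le_sum fun j _ => ?_
            have := hcoord j
            rw [Real.norm_eq_abs]
            gcongr
            simpa using this
        _ = n * s ^ 2 := by simp
        _ ≤ (n * s) ^ 2 := by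
            rw [mul_pow]
            gcongr
            rcases Nat.eq_zero_or_pos n with rfl | hn
            · simp
            · exact_mod_cast Nat.le_self_pow two_ne_zero n
    linarith
  · have hxn : ‖x‖ ≤ ‖x₀‖ + R := by
      have := mem_ball_iff_norm.1 hx
      have h2 := norm_le_norm_add_norm_sub' x x₀
      linarith
    have hu : ∀ j, |x j / s| ≤ L := fun j => by
      rw [abs_div, abs_of_pos hs]
      refine le_trans ?_ hL
      gcongr
      exact (PiLp.norm_apply_le x j).trans hxn
    have hu0 : ∀ j, 0 ≤ x j / s + L := fun j => by linarith [(abs_le.1 (hu j)).1]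
    constructor
    · unfold gridBump
      rw [← Finset.prod_univ_sum (fun _ : Fin n => Finset.range (2 * L + 1))
        (fun j k => unitBump (x j / s + L - k))]
      refine Finset.prod_eq_one fun j _ => sum_range_unitBump (hu0 j) ?_
      push_cast
      linarith [(abs_le.1 (hu j)).2]
    -- Active indices differ from the floor by at most 1 in each coordinate; truncated subtraction
    -- at 0 only shortens the interval.
    · set P : Finset (Fin n → ℕ) := Fintype.piFinset fun j =>
        Finset.Icc (⌊x j / s + L⌋₊ - 1) (⌊x j / s + L⌋₊ + 1) with hP
      have hcard : (P.card : ℝ) ≤ 3 ^ n := by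
        rw [hP, Fintype.card_piFinset]
        have : ∏ j : Fin n, (Finset.Icc (⌊x j / s + L⌋₊ - 1) (⌊x j / s + L⌋₊ + 1)).card ≤
            ∏ _j : Fin n, 3 := Finset.prod_le_prod' fun j _ => by rw [Nat.card_Icc]; omega
        exact_mod_cast this.trans (by simp)
      have hmem : ∀ k, fderiv ℝ (gridBump s L k) x ≠ 0 → k ∈ P := by
        intro k hk
        have hx' := tsupport_gridBump_subset s L k (support_fderiv_subset ℝ hk)
        rw [hP, Fintype.mem_piFinset]
        intro j
        have h1 := abs_le.1 (hx' j)
        have h2 := Nat.floor_le (hu0 j)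
        have h3 := Nat.lt_floor_add_one (x j / s + L)
        rw [Finset.mem_Icc]
        constructor
        · rw [tsub_le_iff_right, ← Nat.lt_add_one_iff]
          have : (⌊x j / s + L⌋₊ : ℝ) < k j + 1 + 1 := by linarith
          exact_mod_cast this
        · rw [← Nat.lt_add_one_iff]
          have : (k j : ℝ) < ⌊x j / s + L⌋₊ + 1 + 1 := by linarith
          exact_mod_cast this
      set T : Finset (Fin n → ℕ) := Fintype.piFinset fun _ => Finset.range (2 * L + 1)
      calc ∑ k ∈ T, ‖fderiv ℝ (gridBump s L k) x‖
          = ∑ k ∈ T with k ∈ P, ‖fderiv ℝ (gridBump s L k) x‖ := by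
            rw [Finset.sum_filter]
            refine Finset.sum_congr rfl fun k _ => ?_
            split_ifs with h
            · rfl
            · rw [not_imp_comm.1 (hmem k) h, norm_zero]
        _ ≤ ∑ k ∈ P, ‖fderiv ℝ (gridBump s L k) x‖ :=
            Finset.sum_le_sum_of_subset_of_nonneg
              (fun k hk => (Finset.mem_filter.1 hk).2) fun _ _ _ => norm_nonneg _
        _ ≤ ∑ _k ∈ P, n * (C / s) :=
            Finset.sum_le_sum fun k _ => norm_fderiv_gridBump_le hs L k hC x
        _ = P.card * (n * (C / s)) := by simp
        _ ≤ 3 ^ n * ((n + 1) * (C / s)) := by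
            gcongr
            linarith
        _ = 3 ^ n * ((n + 1) * C) / s := by ring

/-! ### Good points and regular integrands near a frozen one -/

/-- `g` is `C²` and its second derivative is bounded below with exponent `p` and constant `m`, and
above with exponent `q` and constant `M`. -/
def HasPQGrowth {n : ℕ} (p q m M : ℝ) (g : E n → ℝ) : Prop :=
  ContDiff ℝ 2 g ∧
    (∀ ξ v : E n, m * (1 + ‖ξ‖ ^ 2) ^ ((p - 2) / 2) * ‖v‖ ^ 2 ≤ fderiv ℝ (fderiv ℝ g) ξ v v) ∧
    ∀ ξ : E n, ‖fderiv ℝ (fderiv ℝ g) ξ‖ ≤ M * (1 + ‖ξ‖ ^ 2) ^ ((q - 2) / 2)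

/-- Inside a ball, there is a dense set of points at which the structure conditions hold and between
which `f_ξ` is Lipschitz in `x`, uniformly with respect to the growth in `ξ`. -/
theorem exists_dense_regular_points {n : ℕ} {p q m M K : ℝ} {Ω : Set (E n)}
    {f : E n → E n → ℝ} (hΩ : IsOpen Ω) (h1 : H1 Ω f) (h2 : H2 p m Ω f) (h3 : H3 q M Ω f)
    (h4 : H4 q K Ω f) {x₀ : E n} {r : ℝ} (hr : Metric.closedBall x₀ r ⊆ Ω) :
    ∃ G ⊆ Metric.ball x₀ r,
      (∀ y ∈ Metric.ball x₀ r, ∀ δ > 0, ∃ x ∈ G, ‖x - y‖ < δ) ∧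
      (∀ x ∈ G, HasPQGrowth p q m M (f x)) ∧
      ∀ x ∈ G, ∀ y ∈ G, ∀ ξ : E n, ‖fderiv ℝ (f x) ξ - fderiv ℝ (f y) ξ‖ ≤
        K * (1 + ‖ξ‖ ^ 2) ^ ((q - 1) / 2) * ‖x - y‖ := by
  obtain ⟨A, hA, hAb⟩ := h4
  have hBΩ : Metric.ball x₀ r ⊆ Ω := Metric.ball_subset_closedBall.trans hr
  choose Gξ hGae hGlip using fun ξ : E n =>
    (hA ξ).exists_lipschitz hΩ hr (hAb.mono fun x hx => hx ξ)
  -- The exceptional null set from (H4) depends on `ξ`. A countable dense set of `ξ` leaves one null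
  -- set, and continuity of `f_ξ` in `ξ` at good points recovers the rest.
  set d := TopologicalSpace.denseSeq (E n)
  have hall : ∀ᵐ x ∂(volume : Measure (E n)), ∀ k, x ∈ Gξ (d k) :=
    ae_all_iff.2 fun k => hGae (d k)
  have hae : ∀ᵐ x ∂(volume.restrict (Metric.ball x₀ r)), x ∈ Metric.ball x₀ r ∧
      (∀ k, x ∈ Gξ (d k)) ∧ HasPQGrowth p q m M (f x) := by
    filter_upwards [ae_restrict_mem Metric.isOpen_ball.measurableSet, ae_restrict_of_ae hall,
      ae_restrict_of_ae_restrict_of_subset hBΩ h1, ae_restrict_of_ae_restrict_of_subset hBΩ h2,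
      ae_restrict_of_ae_restrict_of_subset hBΩ h3] with x a1 a2 a3 a4 a5
    exact ⟨a1, a2, a3, a4, a5⟩
  refine ⟨{x | x ∈ Metric.ball x₀ r ∧ (∀ k, x ∈ Gξ (d k)) ∧ HasPQGrowth p q m M (f x)},
    fun x hx => hx.1, fun y hy δ hδ => ?_, fun x hx => hx.2.2, ?_⟩
  · set U := Metric.ball y δ ∩ Metric.ball x₀ r
    have hUo : IsOpen U := Metric.isOpen_ball.inter Metric.isOpen_ball
    have hne : volume.restrict U ≠ 0 := by
      rw [Ne, Measure.restrict_eq_zero]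
      exact (hUo.measure_pos volume ⟨y, Metric.mem_ball_self hδ, hy⟩).ne'
    have := ae_neBot.2 hne
    obtain ⟨x, hx, hxU⟩ := ((ae_restrict_of_ae_restrict_of_subset inter_subset_right hae).and
      (ae_restrict_mem hUo.measurableSet)).exists
    exact ⟨x, hx, mem_ball_iff_norm.1 hxU.1⟩
  · intro x hx y hy ξ
    have hcont : ∀ x, ContDiff ℝ 2 (f x) → Continuous fun ξ => fderiv ℝ (f x) ξ := fun x hx =>
      hx.continuous_fderiv (by simp)
    refine isClosed_property (TopologicalSpace.denseRange_denseSeq (E n))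
      (p := fun ξ => ‖fderiv ℝ (f x) ξ - fderiv ℝ (f y) ξ‖ ≤
        K * (1 + ‖ξ‖ ^ 2) ^ ((q - 1) / 2) * ‖x - y‖) ?_ (fun k => ?_) ξ
    · refine isClosed_le ((hcont x hx.2.2.1).sub (hcont y hy.2.2.1)).norm
        ((continuous_const.mul (Continuous.rpow_const (by fun_prop) fun ξ => Or.inl ?_)).mul
          continuous_const)
      positivity
    · exact hGlip (d k) x (hx.2.1 k) y (hy.2.1 k) hx.1 hy.1

/-- A `C²` integrand with the structure conditions, as close as desired to `f(y₀, ·)`. -/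
theorem exists_regular_near {n : ℕ} {p q m M K H : ℝ} (hp : p < q) (hq : 1 < q) (hm : 0 < m)
    (hK : 0 < K) (hH : 0 < H) {f : E n → E n → ℝ} {B G : Set (E n)} (hGB : G ⊆ B)
    (hf0 : ∀ x ∈ B, ∀ ξ, 0 ≤ f x ξ)
    (h6 : H6 q H B f)
    (hdense : ∀ y ∈ B, ∀ δ > 0, ∃ x ∈ G, ‖x - y‖ < δ)
    (hG : ∀ x ∈ G, HasPQGrowth p q m M (f x))
    (hlip : ∀ x ∈ G, ∀ y ∈ G, ∀ ξ : E n, ‖fderiv ℝ (f x) ξ - fderiv ℝ (f y) ξ‖ ≤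
        K * (1 + ‖ξ‖ ^ 2) ^ ((q - 1) / 2) * ‖x - y‖)
    {y₀ : E n} (hy₀ : y₀ ∈ B) {τ : ℝ} (hτ : 0 < τ) :
    ∃ g : E n → ℝ, HasPQGrowth p q (m / 2) (M + m) g ∧ (∀ ξ, 0 ≤ g ξ) ∧
      (∀ ξ, |g ξ - f y₀ ξ| ≤ τ) ∧
      ∀ y ∈ G, ∀ ξ : E n, ‖fderiv ℝ g ξ - fderiv ℝ (f y) ξ‖ ≤
        K * (1 + ‖ξ‖ ^ 2) ^ ((q - 1) / 2) * (‖y₀ - y‖ + τ) + τ := by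
  have hone : ∀ ξ : E n, 1 ≤ 1 + ‖ξ‖ ^ 2 := fun ξ => by simp
  have hpos : ∀ ξ : E n, 0 < 1 + ‖ξ‖ ^ 2 := fun ξ => by positivity
  -- The second entry of the minimum lets the gluing error consume at most half of the ellipticity.
  obtain ⟨δ, hδ, hglue⟩ := exists_shellGlue_tolerance
    (fun ξ : E n => min τ (m / 2 * (1 + ‖ξ‖ ^ 2) ^ ((p - 2) / 2)))
    (continuous_const.min (continuous_const.mul
      (Continuous.rpow_const (by fun_prop) fun ξ => Or.inl (hpos ξ).ne')))
    (fun ξ => lt_min hτ (by have := hpos ξ; positivity))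
  -- On `‖ξ‖² ≤ N + 1`, `H` accounts for values and `2 K` for gradients, as consecutive good points
  -- are at distance at most `2 c N`.
  set b : ℕ → ℝ := fun N => (H + 2 * K) * ((N : ℝ) + 2) ^ (q / 2) with hb
  have hb0 : ∀ N, 0 < b N := fun N => by positivity
  set c : ℕ → ℝ := fun N => min τ (δ N / b N) with hc
  have hc0 : ∀ N, 0 < c N := fun N => lt_min hτ (div_pos (hδ N) (hb0 N))
  -- The `N`th function is used on shells `N - 1` and `N`, hence both tolerances; at `N = 0` they
  -- coincide.
  choose x hxG hx using fun N => hdense y₀ hy₀ (min (c N) (c (N - 1))) (lt_min (hc0 _) (hc0 _))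
  have hx1 : ∀ N, ‖x N - y₀‖ ≤ c N := fun N => (hx N).le.trans (min_le_left _ _)
  have hx2 : ∀ N, ‖x (N + 1) - y₀‖ ≤ c N := fun N => (hx (N + 1)).le.trans (min_le_right _ _)
  have hcb : ∀ N, c N * b N ≤ δ N := fun N =>
    (mul_le_mul_of_nonneg_right (min_le_right _ _) (hb0 N).le).trans
      (div_mul_cancel₀ _ (hb0 N).ne').le
  have hfar : ∀ (N : ℕ) (ξ : E n), ‖ξ‖ ^ 2 ≤ N + 1 →
      (1 + ‖ξ‖ ^ 2) ^ (q / 2) ≤ ((N : ℝ) + 2) ^ (q / 2) :=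
    fun N ξ hξ => Real.rpow_le_rpow (hpos ξ).le (by linarith) (by linarith)
  have hclose : ∀ (N : ℕ) (ξ : E n), ‖ξ‖ ^ 2 ≤ N + 1 → ∀ y ∈ G, ‖y - y₀‖ ≤ c N →
      |f y ξ - f y₀ ξ| ≤ δ N := fun N ξ hξ y hy hyc => by
    refine (h6 y (hGB hy) y₀ hy₀ ξ).trans (le_trans ?_ (hcb N))
    have h1 := hfar N ξ hξ
    calc H * ‖y - y₀‖ * (1 + ‖ξ‖ ^ 2) ^ (q / 2) ≤ (H + 2 * K) * c N * ((N : ℝ) + 2) ^ (q / 2) := by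
          gcongr
          · have := hc0 N; positivity
          · linarith
      _ = c N * b N := by rw [hb]; ring
  have hmain := hglue (fun N => f (x N)) (f y₀) (fun N => (hG _ (hxG N)).1) (by
    intro N ξ hξ
    refine ⟨hclose N ξ hξ _ (hxG N) (hx1 N), hclose N ξ hξ _ (hxG _) (hx2 N), ?_⟩
    refine (hlip _ (hxG _) _ (hxG _) ξ).trans (le_trans ?_ (hcb N))
    have h1 : ‖x (N + 1) - x N‖ ≤ 2 * c N := by
      have := norm_sub_le_norm_sub_add_norm_sub (x (N + 1)) y₀ (x N)
      rw [norm_sub_rev y₀] at this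
      linarith [hx1 N, hx2 N]
    have h2 : (1 + ‖ξ‖ ^ 2) ^ ((q - 1) / 2) ≤ ((N : ℝ) + 2) ^ (q / 2) :=
      (Real.rpow_le_rpow_of_exponent_le (hone ξ) (by linarith)).trans (hfar N ξ hξ)
    calc K * (1 + ‖ξ‖ ^ 2) ^ ((q - 1) / 2) * ‖x (N + 1) - x N‖
        ≤ K * ((N : ℝ) + 2) ^ (q / 2) * (2 * c N) := by gcongr
      _ ≤ H * ((N : ℝ) + 2) ^ (q / 2) * c N + K * ((N : ℝ) + 2) ^ (q / 2) * (2 * c N) :=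
          le_add_of_nonneg_left (by have := hc0 N; positivity)
      _ = c N * b N := by rw [hb]; ring)
  refine ⟨shellGlue fun N => f (x N), ⟨shellGlue_contDiff fun N => (hG _ (hxG N)).1,
    fun ξ v => ?_, fun ξ => ?_⟩, fun ξ => ?_, fun ξ => ?_, fun y hy ξ => ?_⟩
  all_goals obtain ⟨N, t, ⟨ht0, ht1⟩, e1, e2, e3, e4⟩ := hmain ξ
  · have e4' := e4.trans (min_le_right _ _)
    set T := fderiv ℝ (fderiv ℝ (shellGlue fun N => f (x N))) ξ
    set S := (1 - t) • fderiv ℝ (fderiv ℝ (f (x N))) ξ +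
      t • fderiv ℝ (fderiv ℝ (f (x (N + 1)))) ξ with hS
    have h1 : |T v v - S v v| ≤ m / 2 * (1 + ‖ξ‖ ^ 2) ^ ((p - 2) / 2) * ‖v‖ ^ 2 := by
      have := (T - S).le_opNorm₂ v v
      rw [sub_apply, sub_apply, Real.norm_eq_abs] at this
      refine this.trans ?_
      rw [mul_assoc, ← sq]
      gcongr
    have h2 : m * (1 + ‖ξ‖ ^ 2) ^ ((p - 2) / 2) * ‖v‖ ^ 2 ≤ S v v := by
      have a1 := (hG _ (hxG N)).2.1 ξ v
      have a2 := (hG _ (hxG (N + 1))).2.1 ξ v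
      simp only [hS, add_apply, smul_apply, smul_eq_mul]
      nlinarith
    have := (abs_le.1 h1).1
    linarith
  · have a1 := (hG _ (hxG N)).2.2 ξ
    have a2 := (hG _ (hxG (N + 1))).2.2 ξ
    have e4' := e4.trans (min_le_right _ _)
    set T := fderiv ℝ (fderiv ℝ (shellGlue fun N => f (x N))) ξ
    set S₁ := fderiv ℝ (fderiv ℝ (f (x N))) ξ
    set S₂ := fderiv ℝ (fderiv ℝ (f (x (N + 1)))) ξ
    have h1 : ‖T‖ ≤ ‖T - ((1 - t) • S₁ + t • S₂)‖ + ((1 - t) * ‖S₁‖ + t * ‖S₂‖) := by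
      have b1 : ‖(1 - t) • S₁‖ ≤ (1 - t) * ‖S₁‖ := by
        refine (ContinuousLinearMap.opNorm_smul_le _ _).trans_eq ?_
        rw [Real.norm_of_nonneg (sub_nonneg.2 ht1)]
      have b2 : ‖t • S₂‖ ≤ t * ‖S₂‖ := by
        refine (ContinuousLinearMap.opNorm_smul_le _ _).trans_eq ?_
        rw [Real.norm_of_nonneg ht0]
      have b3 := ContinuousLinearMap.opNorm_add_le ((1 - t) • S₁) (t • S₂)
      have b4 := ContinuousLinearMap.opNorm_add_le (T - ((1 - t) • S₁ + t • S₂))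
        ((1 - t) • S₁ + t • S₂)
      rw [sub_add_cancel] at b4
      linarith
    -- Since `p < q`, the error measured with exponent `p` is absorbed in the upper bound with
    -- exponent `q`.
    have h2 : (1 + ‖ξ‖ ^ 2) ^ ((p - 2) / 2) ≤ (1 + ‖ξ‖ ^ 2) ^ ((q - 2) / 2) :=
      Real.rpow_le_rpow_of_exponent_le (hone ξ) (by linarith)
    have h3 : 0 ≤ (1 + ‖ξ‖ ^ 2) ^ ((q - 2) / 2) := by positivity
    nlinarith [mul_le_mul_of_nonneg_left h2 hm.le, mul_nonneg hm.le h3]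
  · rw [e1]
    have := hf0 _ (hGB (hxG N)) ξ
    have := hf0 _ (hGB (hxG (N + 1))) ξ
    have := sub_nonneg.2 ht1
    positivity
  · exact e2.trans (min_le_left _ _)
  · have e3' := e3.trans (min_le_left _ _)
    have hk : ∀ k, ‖fderiv ℝ (f (x k)) ξ - fderiv ℝ (f y) ξ‖ ≤
        K * (1 + ‖ξ‖ ^ 2) ^ ((q - 1) / 2) * (‖y₀ - y‖ + τ) := fun k => by
      refine (hlip _ (hxG k) _ hy ξ).trans ?_
      gcongr
      have := norm_sub_le_norm_sub_add_norm_sub (x k) y₀ y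
      linarith [(hx1 k).trans (min_le_left _ _)]
    have a1 := hk N
    have a2 := hk (N + 1)
    set W := fderiv ℝ (f y) ξ
    set S₁ := fderiv ℝ (f (x N)) ξ
    set S₂ := fderiv ℝ (f (x (N + 1))) ξ
    rw [show fderiv ℝ (shellGlue fun N => f (x N)) ξ - W =
      (fderiv ℝ (shellGlue fun N => f (x N)) ξ - ((1 - t) • S₁ + t • S₂)) +
        ((1 - t) • (S₁ - W) + t • (S₂ - W)) by module]
    refine (norm_add_le _ _).trans ?_
    have b := norm_add_le ((1 - t) • (S₁ - W)) (t • (S₂ - W))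
    rw [norm_smul, norm_smul, Real.norm_of_nonneg (sub_nonneg.2 ht1),
      Real.norm_of_nonneg ht0] at b
    nlinarith

/-! ### Convex combinations with smooth coefficients -/

theorem HasPQGrowth.strictConvexOn {n : ℕ} {p q m M : ℝ} {g : E n → ℝ}
    (h : HasPQGrowth p q m M g) (hm : 0 < m) : StrictConvexOn ℝ univ g :=
  strictConvexOn_of_fderiv_fderiv_pos h.1 fun ξ v hv =>
    lt_of_lt_of_le (by
      have := norm_pos_iff.2 hv
      have : 0 < 1 + ‖ξ‖ ^ 2 := by positivity
      positivity) (h.2.1 ξ v)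

theorem hasFDerivAt_sum_mul {n : ℕ} {ι : Type*} {T : Finset ι} {c : ι → ℝ} {g : ι → E n → ℝ}
    (hg : ∀ i ∈ T, ContDiff ℝ 2 (g i)) (ξ : E n) :
    HasFDerivAt (fun ξ => ∑ i ∈ T, c i * g i ξ) (∑ i ∈ T, c i • fderiv ℝ (g i) ξ) ξ :=
  HasFDerivAt.fun_sum fun i hi =>
    (((hg i hi).differentiable (by simp)) ξ).hasFDerivAt.const_mul (c i)

/-- Writing a bound as its own weighted average reduces estimates for convex combinations to
termwise ones. -/
theorem eq_sum_mul_of_sum_eq_one {ι : Type*} {T : Finset ι} {c : ι → ℝ} (hc : ∑ i ∈ T, c i = 1)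
    (y : ℝ) : y = ∑ i ∈ T, c i * y := by
  rw [← Finset.sum_mul, hc, one_mul]

/-- The growth conditions are preserved by convex combinations. -/
theorem HasPQGrowth.sum {n : ℕ} {p q m M : ℝ} {ι : Type*} {T : Finset ι} {c : ι → ℝ}
    {g : ι → E n → ℝ} (hc : ∀ i ∈ T, 0 ≤ c i) (hc1 : ∑ i ∈ T, c i = 1)
    (hg : ∀ i ∈ T, HasPQGrowth p q m M (g i)) :
    HasPQGrowth p q m M (fun ξ => ∑ i ∈ T, c i * g i ξ) := by
  have h1 : fderiv ℝ (fun ξ => ∑ i ∈ T, c i * g i ξ) =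
      fun ξ => ∑ i ∈ T, c i • fderiv ℝ (g i) ξ :=
    funext fun ξ => (hasFDerivAt_sum_mul (fun i hi => (hg i hi).1) ξ).fderiv
  have h2 : ∀ ξ, fderiv ℝ (fderiv ℝ (fun ξ => ∑ i ∈ T, c i * g i ξ)) ξ =
      ∑ i ∈ T, c i • fderiv ℝ (fderiv ℝ (g i)) ξ := fun ξ => by
    rw [h1]
    refine (HasFDerivAt.fun_sum fun i hi => ?_).fderiv
    exact ((((hg i hi).1.fderiv_right (m := 1) (by norm_num)).differentiable
      (by simp)) ξ).hasFDerivAt.const_smul (c i)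
  refine ⟨ContDiff.sum fun i hi => contDiff_const.mul (hg i hi).1, fun ξ v => ?_, fun ξ => ?_⟩
  · rw [h2, sum_apply, sum_apply]
    refine (eq_sum_mul_of_sum_eq_one hc1 _).trans_le ?_
    exact Finset.sum_le_sum fun i hi => mul_le_mul_of_nonneg_left ((hg i hi).2.1 ξ v) (hc i hi)
  · rw [h2]
    refine le_trans ?_ (eq_sum_mul_of_sum_eq_one hc1 _).ge
    refine (norm_sum_le T fun i => c i • fderiv ℝ (fderiv ℝ (g i)) ξ).trans
      (Finset.sum_le_sum fun i hi => ?_)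
    refine (ContinuousLinearMap.opNorm_smul_le _ _).trans ?_
    rw [Real.norm_of_nonneg (hc i hi)]
    exact mul_le_mul_of_nonneg_left ((hg i hi).2.2 ξ) (hc i hi)

/-- Mixed derivatives of a sum of products with smooth coefficients. -/
theorem H4_sum_mul {n : ℕ} {q K : ℝ} {ι : Type*} {T : Finset ι} {a g : ι → E n → ℝ}
    {B : Set (E n)} (hB : MeasurableSet B) (ha : ∀ i ∈ T, ContDiff ℝ ∞ (a i))
    (hg : ∀ i ∈ T, ContDiff ℝ 2 (g i))
    (hbound : ∀ x ∈ B, ∀ ξ, ‖∑ i ∈ T, (fderiv ℝ (a i) x).smulRight (fderiv ℝ (g i) ξ)‖ ≤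
      K * (1 + ‖ξ‖ ^ 2) ^ ((q - 1) / 2)) :
    H4 q K B (fun x ξ => ∑ i ∈ T, a i x * g i ξ) := by
  refine ⟨fun x ξ => ∑ i ∈ T, (fderiv ℝ (a i) x).smulRight (fderiv ℝ (g i) ξ), fun ξ => ?_,
    (ae_restrict_mem hB).mono hbound⟩
  have h1 : (fun x => fderiv ℝ (fun ξ => ∑ i ∈ T, a i x * g i ξ) ξ) =
      fun x => ∑ i ∈ T, a i x • fderiv ℝ (g i) ξ :=
    funext fun x => (hasFDerivAt_sum_mul (c := fun i => a i x) hg ξ).fderiv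
  have h2 : ContDiff ℝ 1 fun x => ∑ i ∈ T, a i x • fderiv ℝ (g i) ξ :=
    ContDiff.sum fun i hi => ((ha i hi).of_le (by simp)).smul contDiff_const
  have h3 : (fun x => ∑ i ∈ T, (fderiv ℝ (a i) x).smulRight (fderiv ℝ (g i) ξ)) =
      fun x => fderiv ℝ (fun x => ∑ i ∈ T, a i x • fderiv ℝ (g i) ξ) x := by
    funext x
    refine (HasFDerivAt.fderiv (HasFDerivAt.fun_sum fun i hi => ?_)).symm
    exact (((ha i hi).differentiable (by simp)) x).hasFDerivAt.smul_const (fderiv ℝ (g i) ξ)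
  rw [h1, h3]
  exact hasWeakDerivOn_of_contDiff h2

/-! ### One approximating integrand at a given accuracy -/

/-- A single approximating integrand of the special structure, with the growth conditions
independent of the accuracy `τ`. -/
theorem exists_approximation (n : ℕ) (q m M K : ℝ) (hq : 1 < q) (hm : 0 < m) (hK : 0 < K) :
    ∃ K' : ℝ, 0 < K' ∧ ∀ (p : ℝ), p < q → ∀ (Ω : Set (E n)) (f : E n → E n → ℝ) (H : ℝ),
      IsOpen Ω → (∀ x ∈ Ω, ∀ ξ, 0 ≤ f x ξ) →
      H1 Ω f → H2 p m Ω f → H3 q M Ω f → H4 q K Ω f → H5 Ω f → 0 < H → H6 q H Ω f →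
      ∀ (x₀ : E n) (R : ℝ), 0 < R → Metric.closedBall x₀ R ⊆ Ω → ∀ τ > 0,
      ∃ (N : ℕ) (a g : ℕ → E n → ℝ),
        (∀ i < N, ContDiff ℝ ∞ (a i) ∧ ∀ x, 0 ≤ a i x) ∧
        (∀ x ∈ Metric.ball x₀ R, ∑ i ∈ Finset.range N, a i x = 1) ∧
        (∀ i < N, (∀ ξ, 0 ≤ g i ξ) ∧ HasPQGrowth p q (m / 2) (M + m) (g i)) ∧
        (∀ x ∈ Metric.ball x₀ R, ∀ ξ,
          ‖∑ i ∈ Finset.range N, (fderiv ℝ (a i) x).smulRight (fderiv ℝ (g i) ξ)‖ ≤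
            K' * (1 + ‖ξ‖ ^ 2) ^ ((q - 1) / 2)) ∧
        ∀ x ∈ Metric.ball x₀ R, ∀ ξ, ∀ i < N, a i x ≠ 0 →
          |g i ξ - f x ξ| ≤ τ * (1 + (1 + ‖ξ‖ ^ 2) ^ (q / 2)) ∧ g i ξ ≤ 2 * f x ξ + 1 := by
  obtain ⟨C, hC, hgrid⟩ := exists_grid_partition n
  -- `C (n + 1) / ε` bounds the sum of gradients. The factor `5 K ε` is `3 ε` from the distance
  -- between the frozen point and `y`, plus two contributions of `ρ`.
  refine ⟨C * (n + 1) * (5 * K), by positivity, ?_⟩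
  intro p hpq Ω f H hΩ hf0 h1 h2 h3 h4 h5 hH h6 x₀ R hR hball τ hτ
  obtain ⟨η, hη, hηΩ⟩ := (isCompact_closedBall x₀ R).exists_cthickening_subset_open hΩ hball
  rw [cthickening_closedBall hη.le hR.le] at hηΩ
  set B := Metric.ball x₀ (η + R) with hB
  have hBΩ : B ⊆ Ω := Metric.ball_subset_closedBall.trans hηΩ
  obtain ⟨G, hGB, hGd, hGg, hGl⟩ := exists_dense_regular_points hΩ h1 h2 h3 h4 hηΩ
  obtain ⟨c, -, hclim, hc⟩ := h5
  -- Any fixed bound on `c ε` would do: (H5) serves only to produce an integrable majorant.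
  have hc2 : ∀ᶠ ε in 𝓝[>] (0 : ℝ), c ε ≤ 2 :=
    (hclim.eventually_lt_const (by norm_num : (1 : ℝ) < 2)).mono fun _ h => h.le
  have hsmall : ∀ᶠ ε in 𝓝[>] (0 : ℝ), ε < min (η / 2) (τ / (2 * H)) :=
    (eventually_lt_nhds (lt_min (by positivity) (by positivity))).filter_mono nhdsWithin_le_nhds
  obtain ⟨ε, ⟨hcε, hεs⟩, hε⟩ := ((hc2.and hsmall).and self_mem_nhdsWithin).exists
  have hε0 : 0 < ε := hε
  have hεη : 2 * ε < η := by linarith [hεs.trans_le (min_le_left _ _)]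
  have hεH : H * (2 * ε) ≤ τ := by
    have := (hεs.trans_le (min_le_right _ _)).le
    rw [le_div_iff₀ (by positivity)] at this
    linarith
  set s := ε / (n + 1) with hs
  have hs0 : 0 < s := by positivity
  have hsε : (n + 1) * s = ε := by rw [hs]; field_simp
  obtain ⟨T, a, z, ha, ha0, hsupp, hsum⟩ := hgrid x₀ R s hs0
  simp only [hsε] at hsupp
  -- The bounds `τ` and 1 serve the closeness and the majorant; `ε` and `K * ε` serve (H4).
  set ρ := min (min τ 1) (min ε (K * ε)) with hρ
  have hρ0 : 0 < ρ := by positivity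
  classical
  -- Bumps not meeting the ball are dropped, since their centres may lie outside `Ω`, where (H5)
  -- says nothing.
  set T' := T.filter fun k => ∃ x ∈ Metric.ball x₀ R, x ∈ tsupport (a k) with hT'
  have hex : ∀ k ∈ T', ∃ g : E n → ℝ, ∃ y₀ : E n, ‖y₀ - z k‖ ≤ ε ∧ y₀ ∈ B ∧
      (∀ y ∈ Metric.ball (z k) ε, y ∈ Ω → ∀ ξ, f y₀ ξ ≤ 2 * f y ξ) ∧
      HasPQGrowth p q (m / 2) (M + m) g ∧ (∀ ξ, 0 ≤ g ξ) ∧ (∀ ξ, |g ξ - f y₀ ξ| ≤ ρ) ∧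
      ∀ y ∈ G, ∀ ξ : E n, ‖fderiv ℝ g ξ - fderiv ℝ (f y) ξ‖ ≤
        K * (1 + ‖ξ‖ ^ 2) ^ ((q - 1) / 2) * (‖y₀ - y‖ + ρ) + ρ := by
    intro k hk
    obtain ⟨x, hx, hxk⟩ := (Finset.mem_filter.1 hk).2
    have hxz := hsupp k x hxk
    have hzx : dist (z k) x₀ < ε + R := by
      have := dist_triangle (z k) x x₀
      have h' := Metric.mem_ball.1 hx
      rw [dist_comm (z k) x, dist_eq_norm x] at this
      linarith
    have hsub : Metric.closedBall (z k) ε ⊆ B := by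
      intro y hy
      have := dist_triangle y (z k) x₀
      have h' := Metric.mem_closedBall.1 hy
      rw [hB, Metric.mem_ball]
      linarith
    obtain ⟨y₀, hy₀, hmin⟩ := hc ε hε0 (z k) (hBΩ (hsub (Metric.mem_closedBall_self hε0.le)))
      (hsub.trans hBΩ)
    obtain ⟨g, hg1, hg2, hg3, hg4⟩ := exists_regular_near hpq hq hm hK hH hGB
      (fun x hx => hf0 x (hBΩ hx)) (fun x hx y hy => h6 x (hBΩ hx) y (hBΩ hy)) hGd hGg hGl
      (hsub hy₀) hρ0
    refine ⟨g, y₀, mem_closedBall_iff_norm.1 hy₀, hsub hy₀, fun y hy hyΩ ξ => ?_, hg1, hg2, hg3,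
      hg4⟩
    exact (hmin y hy ξ).trans (mul_le_mul_of_nonneg_right hcε (hf0 y hyΩ ξ))
  choose! g y₀ hy₀z hy₀B hy₀min hgg hg0 hgclose hgder using hex
  have hRB : Metric.ball x₀ R ⊆ B := Metric.ball_subset_ball (by linarith)
  have hzero : ∀ x ∈ Metric.ball x₀ R, ∀ k ∈ T, k ∉ T' → a k x = 0 ∧ fderiv ℝ (a k) x = 0 := by
    intro x hx k hk hk'
    have hxk : x ∉ tsupport (a k) := fun h => hk' (Finset.mem_filter.2 ⟨hk, x, hx, h⟩)
    exact ⟨image_eq_zero_of_notMem_tsupport hxk,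
      by_contra fun h => hxk (support_fderiv_subset ℝ h)⟩
  have hsum1 : ∀ x ∈ Metric.ball x₀ R, ∑ k ∈ T', a k x = 1 := fun x hx => by
    rw [← (hsum x hx).1]
    exact Finset.sum_subset (Finset.filter_subset _ _) fun k hk hk' => (hzero x hx k hk hk').1
  have hsum0 : ∀ x ∈ Metric.ball x₀ R, ∑ k ∈ T', fderiv ℝ (a k) x = 0 := fun x hx => by
    have e1 : HasFDerivAt (fun x => ∑ k ∈ T', a k x) (∑ k ∈ T', fderiv ℝ (a k) x) x :=
      HasFDerivAt.fun_sum fun k _ => (((ha k).differentiable (by simp)) x).hasFDerivAt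
    have e2 : HasFDerivAt (fun x => ∑ k ∈ T', a k x) (0 : E n →L[ℝ] ℝ) x :=
      (hasFDerivAt_const (1 : ℝ) x).congr_of_eventuallyEq
        ((Metric.isOpen_ball.eventually_mem hx).mono hsum1)
    exact e1.unique e2
  have hfinal : ∀ x ∈ Metric.ball x₀ R, ∀ ξ,
      ‖∑ k ∈ T', (fderiv ℝ (a k) x).smulRight (fderiv ℝ (g k) ξ)‖ ≤
        C * (n + 1) * (5 * K) * (1 + ‖ξ‖ ^ 2) ^ ((q - 1) / 2) := by
    intro x hx ξ
    obtain ⟨y, hyG, hyx⟩ := hGd x (hRB hx) ε hε0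
    set w := (1 + ‖ξ‖ ^ 2) ^ ((q - 1) / 2) with hw
    have hw1 : 1 ≤ w := Real.one_le_rpow (by simp) (by linarith)
    -- One good point `y` near `x` serves all `k`; subtracting its gradient is free because the
    -- gradients of the partition sum to zero.
    have hrew : ∑ k ∈ T', (fderiv ℝ (a k) x).smulRight (fderiv ℝ (g k) ξ) =
        ∑ k ∈ T', (fderiv ℝ (a k) x).smulRight (fderiv ℝ (g k) ξ - fderiv ℝ (f y) ξ) := by
      ext v v'
      have h0 : (∑ k ∈ T', fderiv ℝ (a k) x) v = 0 := by rw [hsum0 x hx]; rfl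
      rw [sum_apply] at h0
      simp only [sum_apply, ContinuousLinearMap.smulRight_apply, smul_apply,
        sub_apply, smul_eq_mul, mul_sub, Finset.sum_sub_distrib]
      rw [← Finset.sum_mul, h0, zero_mul, sub_zero]
    rw [hrew]
    calc ‖∑ k ∈ T', (fderiv ℝ (a k) x).smulRight (fderiv ℝ (g k) ξ - fderiv ℝ (f y) ξ)‖
        ≤ ∑ k ∈ T', ‖(fderiv ℝ (a k) x).smulRight (fderiv ℝ (g k) ξ - fderiv ℝ (f y) ξ)‖ :=
          norm_sum_le T' fun k =>
            (fderiv ℝ (a k) x).smulRight (fderiv ℝ (g k) ξ - fderiv ℝ (f y) ξ)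
      _ ≤ ∑ k ∈ T', ‖fderiv ℝ (a k) x‖ * (5 * K * ε * w) := by
          refine Finset.sum_le_sum fun k hk => ?_
          rw [ContinuousLinearMap.norm_smulRight_apply]
          by_cases hxk : fderiv ℝ (a k) x = 0
          · simp [hxk]
          · refine mul_le_mul_of_nonneg_left ?_ (norm_nonneg _)
            refine (hgder k hk y hyG ξ).trans ?_
            have hxz := hsupp k x (support_fderiv_subset ℝ hxk)
            have hyy : ‖y₀ k - y‖ ≤ 3 * ε := by
              have b1 := norm_sub_le_norm_sub_add_norm_sub (y₀ k) (z k) y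
              have b2 := norm_sub_le_norm_sub_add_norm_sub (z k) x y
              rw [norm_sub_rev (z k) x, norm_sub_rev x y] at b2
              linarith [hy₀z k hk]
            have hρε : ρ ≤ ε := (min_le_right _ _).trans (min_le_left _ _)
            have hρK : ρ ≤ K * ε := (min_le_right _ _).trans (min_le_right _ _)
            have hKε : K * ε ≤ K * ε * w := le_mul_of_one_le_right (by positivity) hw1
            calc K * w * (‖y₀ k - y‖ + ρ) + ρ ≤ K * w * (3 * ε + ε) + K * ε * w := by
                  gcongr
                  exact hρK.trans hKε
              _ = 5 * K * ε * w := by ring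
      _ = (∑ k ∈ T', ‖fderiv ℝ (a k) x‖) * (5 * K * ε * w) := by rw [Finset.sum_mul]
      _ ≤ (C / s) * (5 * K * ε * w) := by
          gcongr
          exact (Finset.sum_le_sum_of_subset_of_nonneg (Finset.filter_subset _ _)
            fun _ _ _ => norm_nonneg _).trans (hsum x hx).2
      _ = C * (n + 1) * (5 * K) * w := by
          rw [← hsε]
          field_simp
  have hnear : ∀ x ∈ Metric.ball x₀ R, ∀ ξ, ∀ k ∈ T', a k x ≠ 0 →
      |g k ξ - f x ξ| ≤ τ * (1 + (1 + ‖ξ‖ ^ 2) ^ (q / 2)) ∧ g k ξ ≤ 2 * f x ξ + 1 := by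
    intro x hx ξ k hk hak
    have hxz := hsupp k x (subset_tsupport _ hak)
    have hxΩ := hBΩ (hRB hx)
    have hclose := hgclose k hk ξ
    have hρτ : ρ ≤ τ := (min_le_left _ _).trans (min_le_left _ _)
    have hρ1 : ρ ≤ 1 := (min_le_left _ _).trans (min_le_right _ _)
    constructor
    · have b1 := abs_sub_le (g k ξ) (f (y₀ k) ξ) (f x ξ)
      have b2 := h6 _ (hBΩ (hy₀B k hk)) x hxΩ ξ
      have b3 : ‖y₀ k - x‖ ≤ 2 * ε := by
        have := norm_sub_le_norm_sub_add_norm_sub (y₀ k) (z k) x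
        rw [norm_sub_rev (z k) x] at this
        linarith [hy₀z k hk]
      have b4 : H * ‖y₀ k - x‖ * (1 + ‖ξ‖ ^ 2) ^ (q / 2) ≤ τ * (1 + ‖ξ‖ ^ 2) ^ (q / 2) := by
        gcongr
        exact (mul_le_mul_of_nonneg_left b3 hH.le).trans hεH
      linarith
    · have b1 := hy₀min k hk x (mem_ball_iff_norm.2 hxz) hxΩ ξ
      linarith [(abs_le.1 hclose).2]
  -- Enumeration of the multi-indices by naturals; the default value 0 of `σ` lies outside the range
  -- summed over.
  set e := T'.equivFin
  obtain ⟨σ, hσmem, hσsum⟩ : ∃ σ : ℕ → (Fin n → ℕ), (∀ i < T'.card, σ i ∈ T') ∧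
      InjOn σ (Finset.range T'.card) ∧ (Finset.range T'.card).image σ = T' := by
    refine ⟨fun i => if h : i < T'.card then (e.symm ⟨i, h⟩ : Fin n → ℕ) else 0,
      fun i hi => ?_, fun i hi j hj hij => ?_, Finset.ext fun k => ⟨fun hk => ?_, fun hk => ?_⟩⟩
    · simp only [hi, dite_true]
      exact (e.symm ⟨i, hi⟩).2
    · have hi' := Finset.mem_range.1 hi
      have hj' := Finset.mem_range.1 hj
      simp only [hi', hj', dite_true] at hij
      simpa using e.symm.injective (Subtype.ext hij)
    · obtain ⟨i, hi, rfl⟩ := Finset.mem_image.1 hk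
      simp only [Finset.mem_range.1 hi, dite_true]
      exact (e.symm ⟨i, _⟩).2
    · exact Finset.mem_image.2 ⟨e ⟨k, hk⟩, by simp, by simp⟩
  have hreindex : ∀ {V : Type} [AddCommMonoid V] (Φ : (Fin n → ℕ) → V),
      ∑ i ∈ Finset.range T'.card, Φ (σ i) = ∑ k ∈ T', Φ k := fun Φ => by
    conv_rhs => rw [← hσsum.2]
    rw [Finset.sum_image hσsum.1]
  refine ⟨T'.card, fun i => a (σ i), fun i => g (σ i), fun i _ => ⟨ha _, ha0 _⟩, fun x hx => ?_,
    fun i hi => ⟨hg0 _ (hσmem i hi), hgg _ (hσmem i hi)⟩, fun x hx ξ => ?_,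
    fun x hx ξ i hi => hnear x hx ξ _ (hσmem i hi)⟩
  · rw [hreindex fun k => a k x, hsum1 x hx]
  · rw [hreindex fun k => (fderiv ℝ (a k) x).smulRight (fderiv ℝ (g k) ξ)]
    exact hfinal x hx ξ

end PQGrowth

/-! ### The approximating sequence -/

theorem theorem2p1 (n : ℕ) (hn : 1 ≤ n) (p q m M K : ℝ)
    (hp : 1 < p) (hpq : p < q) (hgap : q ≤ p * (((n : ℝ) + 1) / n))
    (hm : 0 < m) (hM : 0 < M) (hK : 0 < K) :
    -- the constants of the approximating integrands: independent of `h` (and of `Ω`, `f`, the ball)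
    ∃ m' M' K' : ℝ, 0 < m' ∧ 0 < M' ∧ 0 < K' ∧
    ∀ (Ω : Set (PQGrowth.E n)) (f : PQGrowth.E n → PQGrowth.E n → ℝ) (H : ℝ),
      IsOpen Ω →
      (∀ x ∈ Ω, ∀ ξ, 0 ≤ f x ξ) →
      (∀ x ∈ Ω, StrictConvexOn ℝ Set.univ (f x)) →
      PQGrowth.H1 Ω f → PQGrowth.H2 p m Ω f → PQGrowth.H3 q M Ω f → PQGrowth.H4 q K Ω f →
      PQGrowth.H5 Ω f → 0 < H → PQGrowth.H6 q H Ω f →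
      ∀ (x₀ : PQGrowth.E n) (R : ℝ), 0 < R → Metric.closedBall x₀ R ⊆ Ω →
      ∃ (F : ℕ → PQGrowth.E n → PQGrowth.E n → ℝ) (N : ℕ → ℕ)
        (a g : ℕ → ℕ → PQGrowth.E n → ℝ),
        -- the special structure, with a smooth partition of unity in `x`
        (∀ h, ∀ x ∈ Metric.ball x₀ R, ∀ ξ,
          F h x ξ = ∑ i ∈ Finset.range (N h), a h i x * g h i ξ) ∧
        (∀ h, ∀ i < N h, ContDiff ℝ ∞ (a h i) ∧ ∀ x, 0 ≤ a h i x) ∧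
        (∀ h, ∀ x ∈ Metric.ball x₀ R, ∑ i ∈ Finset.range (N h), a h i x = 1) ∧
        (∀ h, ∀ i < N h, (∀ ξ, 0 ≤ g h i ξ) ∧ StrictConvexOn ℝ Set.univ (g h i)) ∧
        -- nonnegativity, strict convexity, and the growth conditions uniformly in `h`
        (∀ h, ∀ x ∈ Metric.ball x₀ R,
          (∀ ξ, 0 ≤ F h x ξ) ∧ StrictConvexOn ℝ Set.univ (F h x)) ∧
        (∀ h, PQGrowth.H1 (Metric.ball x₀ R) (F h) ∧
          PQGrowth.H2 p m' (Metric.ball x₀ R) (F h) ∧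
          PQGrowth.H3 q M' (Metric.ball x₀ R) (F h) ∧
          PQGrowth.H4 q K' (Metric.ball x₀ R) (F h)) ∧
        -- uniform convergence on `B_R × C` for every compact `C`
        (∀ C : Set (PQGrowth.E n), IsCompact C →
          TendstoUniformlyOn (fun h (z : PQGrowth.E n × PQGrowth.E n) => F h z.1 z.2)
            (fun z => f z.1 z.2) atTop (Metric.ball x₀ R ×ˢ C)) ∧
        -- one subsequence, the same for all `u`, along which the energies converge
        ∃ k : ℕ → ℕ, StrictMono k ∧
          ∀ (u : PQGrowth.E n → ℝ) (Du : PQGrowth.E n → PQGrowth.E n),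
            PQGrowth.MemW1p p (Metric.ball x₀ R) u Du →
            IntegrableOn (fun x => f x (Du x)) (Metric.ball x₀ R) volume →
            (∀ j, IntegrableOn (fun x => F (k j) x (Du x)) (Metric.ball x₀ R) volume) ∧
            Tendsto (fun j => ∫ x in Metric.ball x₀ R, F (k j) x (Du x)) atTop
              (𝓝 (∫ x in Metric.ball x₀ R, f x (Du x))) := by
  obtain ⟨K', hK', happ⟩ := PQGrowth.exists_approximation n q m M K (hp.trans hpq) hm hK
  refine ⟨m / 2, M + m, K', by positivity, by positivity, hK', ?_⟩
  intro Ω f H hΩ hf0 _ h1 h2 h3 h4 h5 hH h6 x₀ R hR hball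
  choose N a g ha hsum hg hmix hnear using fun h : ℕ =>
    happ p hpq Ω f H hΩ hf0 h1 h2 h3 h4 h5 hH h6 x₀ R hR hball (1 / ((h : ℝ) + 1)) (by positivity)
  set B := Metric.ball x₀ R
  have hBΩ : B ⊆ Ω := Metric.ball_subset_closedBall.trans hball
  have hBm : MeasurableSet B := Metric.isOpen_ball.measurableSet
  have hBfin : volume B ≠ ⊤ := measure_ball_lt_top.ne
  set F : ℕ → PQGrowth.E n → PQGrowth.E n → ℝ := fun h x ξ =>
    ∑ i ∈ Finset.range (N h), a h i x * g h i ξ with hF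
  have hgrowth : ∀ h, ∀ x ∈ B, PQGrowth.HasPQGrowth p q (m / 2) (M + m) (F h x) := fun h x hx =>
    PQGrowth.HasPQGrowth.sum (fun i hi => (ha h i (Finset.mem_range.1 hi)).2 x) (hsum h x hx)
      fun i hi => (hg h i (Finset.mem_range.1 hi)).2
  have hF0 : ∀ h x ξ, 0 ≤ F h x ξ := fun h x ξ => Finset.sum_nonneg fun i hi =>
    mul_nonneg ((ha h i (Finset.mem_range.1 hi)).2 x) ((hg h i (Finset.mem_range.1 hi)).1 ξ)
  have hFle : ∀ h, ∀ x ∈ B, ∀ ξ, F h x ξ ≤ 2 * f x ξ + 1 := fun h x hx ξ => by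
    refine le_trans ?_ (PQGrowth.eq_sum_mul_of_sum_eq_one (hsum h x hx) _).ge
    refine Finset.sum_le_sum fun i hi => ?_
    rcases eq_or_ne (a h i x) 0 with h0 | h0
    · simp [h0]
    · exact mul_le_mul_of_nonneg_left (hnear h x hx ξ i (Finset.mem_range.1 hi) h0).2
        ((ha h i (Finset.mem_range.1 hi)).2 x)
  have hFclose : ∀ h, ∀ x ∈ B, ∀ ξ, |F h x ξ - f x ξ| ≤
      1 / ((h : ℝ) + 1) * (1 + (1 + ‖ξ‖ ^ 2) ^ (q / 2)) := fun h x hx ξ => by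
    have e1 : F h x ξ - f x ξ = ∑ i ∈ Finset.range (N h), a h i x * (g h i ξ - f x ξ) := by
      simp only [hF, mul_sub, Finset.sum_sub_distrib]
      rw [← Finset.sum_mul, hsum h x hx, one_mul]
    rw [e1]
    refine le_trans ?_ (PQGrowth.eq_sum_mul_of_sum_eq_one (hsum h x hx) _).ge
    refine (Finset.abs_sum_le_sum_abs _ _).trans (Finset.sum_le_sum fun i hi => ?_)
    rw [abs_mul, abs_of_nonneg ((ha h i (Finset.mem_range.1 hi)).2 x)]
    rcases eq_or_ne (a h i x) 0 with h0 | h0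
    · simp [h0]
    · exact mul_le_mul_of_nonneg_left (hnear h x hx ξ i (Finset.mem_range.1 hi) h0).1
        ((ha h i (Finset.mem_range.1 hi)).2 x)
  have hlim : ∀ b : ℝ, Tendsto (fun h : ℕ => 1 / ((h : ℝ) + 1) * b) atTop (𝓝 0) := fun b => by
    simpa using (tendsto_one_div_add_atTop_nhds_zero_nat (𝕜 := ℝ)).mul_const b
  refine ⟨F, N, a, g, fun _ _ _ _ => rfl, ha, hsum,
    fun h i hi => ⟨(hg h i hi).1, (hg h i hi).2.strictConvexOn (by positivity)⟩,
    fun h x hx => ⟨hF0 h x, (hgrowth h x hx).strictConvexOn (by positivity)⟩,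
    fun h => ⟨(ae_restrict_mem hBm).mono fun x hx => (hgrowth h x hx).1,
      (ae_restrict_mem hBm).mono fun x hx => (hgrowth h x hx).2.1,
      (ae_restrict_mem hBm).mono fun x hx => (hgrowth h x hx).2.2,
      PQGrowth.H4_sum_mul hBm (fun i hi => (ha h i (Finset.mem_range.1 hi)).1)
        (fun i hi => (hg h i (Finset.mem_range.1 hi)).2.1) (hmix h)⟩,
    -- The energies converge along the whole sequence, so the identity serves as the subsequence for
    -- every `u`.
    fun C hC => ?_, id, strictMono_id, fun u Du hu hint => ?_⟩
  · have hcont : Continuous fun ξ : PQGrowth.E n => (1 + ‖ξ‖ ^ 2) ^ (q / 2) :=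
      Continuous.rpow_const (by fun_prop) fun ξ => Or.inl (by positivity)
    obtain ⟨b, hb⟩ := hC.exists_bound_of_continuousOn hcont.continuousOn
    rw [Metric.tendstoUniformlyOn_iff]
    intro ε hε
    filter_upwards [(hlim (1 + b)).eventually_lt_const hε] with h hh z hz
    rw [dist_comm, Real.dist_eq]
    refine lt_of_le_of_lt ((hFclose h z.1 hz.1 z.2).trans ?_) hh
    gcongr
    exact (le_abs_self _).trans (hb z.2 hz.2)
  · have hmeas : ∀ h, AEStronglyMeasurable (fun x => F h x (Du x)) (volume.restrict B) :=
      fun h => Finset.aestronglyMeasurable_fun_sum _ fun i hi =>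
        (ha h i (Finset.mem_range.1 hi)).1.continuous.aestronglyMeasurable.mul
          ((hg h i (Finset.mem_range.1 hi)).2.1.continuous.comp_aestronglyMeasurable
            hu.2.1.aestronglyMeasurable)
    -- This majorant is independent of `h` and integrable because the ball has finite measure; the
    -- error bound with exponent `q` is then needed only pointwise.
    have hdom : Integrable (fun x => 2 * f x (Du x) + 1) (volume.restrict B) :=
      (hint.const_mul 2).add (integrableOn_const hBfin)
    have hbound : ∀ h, ∀ᵐ x ∂(volume.restrict B), ‖F h x (Du x)‖ ≤ 2 * f x (Du x) + 1 :=
      fun h => (ae_restrict_mem hBm).mono fun x hx => by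
        rw [Real.norm_of_nonneg (hF0 h x _)]
        exact hFle h x hx _
    refine ⟨fun j => hdom.mono' (hmeas j) (hbound j),
      tendsto_integral_of_dominated_convergence _ hmeas hdom hbound
        ((ae_restrict_mem hBm).mono fun x hx => ?_)⟩
    rw [tendsto_iff_dist_tendsto_zero]
    exact squeeze_zero (fun _ => dist_nonneg)
      (fun h => by rw [Real.dist_eq]; exact hFclose h x hx _) (hlim _)
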